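/- Let $k$ be a field, let $G$ be an algebraic group over $k$ (a $k$-group scheme of finite type), and let $H$ be an étale $k$-group scheme (not necessarily of finite type). For a $k$-scheme $X$, let $\mathbf{Hom}(X,H)$ be the contravariant group functor on $k$-schemes that sends $S$ to the group $\mathrm{Hom}_k(X\times_k S,\,H)\cong \mathrm{Hom}_S(X\times_k S,\,H\times_k S)$, with pointwise multiplication in $H$, and sends $u:S'\to S$ to $f\mapsto f\circ(\mathrm{id}_X\times u)$. Let $\pi_0(G)=\operatorname{Spec}\pi(\mathcal O(G))$ be the étale scheme of connected components of $G$, where $\pi(\mathcal O(G))$ is the largest étale $k$-subalgebra of $\mathcal O(G)=\Gamma(G,\mathcal O_G)$, and let $\gamma:G\to\pi_0(G)$ be the canonical morphism, given by the inclusion $\pi(\mathcal O(G))\subseteq\mathcal O(G)$. (i) The pullback $\gamma^*:\mathbf{Hom}(\pi_0(G),H)\to\mathbf{Hom}(G,H)$, $f\mapsto f\circ(\gamma\times\mathrm{id}_S)$, is an isomorphism of group functors. (ii) The group functor $\mathbf{Hom}(G,H)$ is represented by an étale $k$-group scheme $N$. If $H$ is finite over $k$, then $N$ is finite over $k$ as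 well. -/

import Mathlib

universe u

open CategoryTheory MonoidalCategory AlgebraicGeometry Opposite

noncomputable section

namespace HomEtale

section Algebra

variable (k : Type u) [Field k] (A : Type u) [CommRing A] [Algebra k A]

/-- The largest étale subalgebra `π(A)` of a `k`-algebra `A`: the subalgebra generated by all
étale `k`-subalgebras. -/
def maxEtaleSubalgebra : Subalgebra k A :=
  sSup {B : Subalgebra k A | Algebra.Etale k B}

end Algebra

variable {k : Type u} [Field k]

/-- The ring `𝒪(X)` of global functions of a `k`-scheme `X`. -/
def GlobalFunctions (X : Over (Spec (.of k))) : Type u := Γ(X.left, ⊤)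

instance (X : Over (Spec (.of k))) : CommRing (GlobalFunctions X) :=
  inferInstanceAs (CommRing Γ(X.left, ⊤))

/-- `𝒪(X)` is a `k`-algebra through the structural morphism `X ⟶ Spec k`. -/
instance (X : Over (Spec (.of k))) : Algebra k (GlobalFunctions X) :=
  RingHom.toAlgebra (S := GlobalFunctions X)
    ((Scheme.ΓSpecIso (.of k)).inv ≫ X.hom.appTop).hom

/-- The scheme of connected components `π₀(X)` of a `k`-scheme `X` of finite type: the spectrum
of the largest étale subalgebra of `𝒪(X)`. -/
def piZero (X : Over (Spec (.of k))) : Over (Spec (.of k)) :=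
  Over.mk (Spec.map (CommRingCat.ofHom
    (algebraMap k (maxEtaleSubalgebra k (GlobalFunctions X)))))

/-- The inclusion of the largest étale subalgebra into `𝒪(X)`. -/
def piZeroInclusion (X : Over (Spec (.of k))) :
    CommRingCat.of (maxEtaleSubalgebra k (GlobalFunctions X)) ⟶ Γ(X.left, ⊤) :=
  CommRingCat.ofHom (S := Γ(X.left, ⊤))
    (maxEtaleSubalgebra k (GlobalFunctions X)).val.toRingHom

theorem algebraMap_piZeroInclusion (X : Over (Spec (.of k))) :
    CommRingCat.ofHom (algebraMap k (maxEtaleSubalgebra k (GlobalFunctions X))) ≫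
      piZeroInclusion X = (Scheme.ΓSpecIso (.of k)).inv ≫ X.hom.appTop := rfl

/-- The canonical morphism `γ : X ⟶ π₀(X)` over `k`, given by the inclusion of the largest étale
subalgebra into `𝒪(X)`. -/
def toPiZero (X : Over (Spec (.of k))) : X ⟶ piZero X :=
  Over.homMk (X.left.toSpecΓ ≫ Spec.map (piZeroInclusion X))
    (by
      change (X.left.toSpecΓ ≫ Spec.map _) ≫ Spec.map _ = X.hom
      rw [Category.assoc, ← Spec.map_comp, algebraMap_piZeroInclusion, Spec.map_comp,
        ← Scheme.toSpecΓ_naturality_assoc]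
      simp)

/-- The group functor `𝐇𝐨𝐦(X, H)` on `k`-schemes, for a `k`-scheme `X` and a `k`-group scheme `H`:
it sends `S` to the group of `k`-morphisms `X × S ⟶ H` under pointwise multiplication in `H`, and
`u : S' ⟶ S` to precomposition with `(id, u) : X × S' ⟶ X × S`. -/
def homFunctor (X H : Over (Spec (.of k))) [GrpObj H] :
    (Over (Spec (.of k)))ᵒᵖ ⥤ GrpCat.{u} :=
  (tensorLeft X).op ⋙ yonedaGrpObj H

/-- The pullback `φ^* : 𝐇𝐨𝐦(X, H) ⟶ 𝐇𝐨𝐦(X', H)` along `φ : X' ⟶ X`, sending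
`f : X × S ⟶ H` to `f ∘ (φ, id) : X' × S ⟶ H`. -/
def homFunctorPullback {X' X : Over (Spec (.of k))} (φ : X' ⟶ X)
    (H : Over (Spec (.of k))) [GrpObj H] : homFunctor X H ⟶ homFunctor X' H :=
  Functor.whiskerRight (NatTrans.op ((curriedTensor _).map φ)) (yonedaGrpObj H)

end HomEtale

end

noncomputable section

namespace HomEtale

section

open scoped TensorProduct

/-! ### Étale subalgebras and idempotents. -/

section Algebra

/-! Let `A = 𝒪(G)` and `P = π(A)`. An idempotent of `K ⊗[k] A` is killed by every `K`-derivation, so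
its coefficients over a `k`-basis of `K` generate an unramified, hence étale, subalgebra: all
idempotents come from `K ⊗[k] P`. Moreover `P` is itself étale, because the dimension of an étale
subalgebra is bounded by a number of geometric irreducible components. Hence `K ⊗[P] A` is a direct
factor of `K ⊗[k] A`, and for a field `K` it has no nontrivial idempotents. By flat base change this
ring is the ring of functions on a fibre of `γ`, so `γ` is geometrically connected
(`geometricallyConnected_toPiZero_left`).

For (i), `γ × id` is flat, quasi-compact and surjective, so morphisms descend along it as soon as
their two pullbacks to the self-product agree. These agree on the diagonal. Since `H` is étale, the
locus of agreement is open and closed, and the connected fibres of a projection carry it from the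
diagonal to the whole self-product (`bijective_toPiZero_whiskerRight_comp`).

For (ii), (i) replaces `G` by the finite étale scheme `E = Spec P`. If `H` is affine, the
representing object is a Weil restriction; it inherits étaleness through infinitesimal lifting, and
an étale algebra over a field is finite. For general `H`, a morphism `E × S ⟶ H` sends the fibre
over each `s` to a finite set `U` of points, which is locally constant in `s`. Each `U` is a finite
discrete, hence affine, open subscheme of `H`, and the representing scheme is a disjoint union over
all `U`. -/

theorem Derivation.apply_eq_zero_of_isIdempotentElem {R A M : Type*} [CommRing R] [CommRing A]
    [Algebra R A] [AddCommGroup M] [Module A M] [Module R M] (D : Derivation R A M) {e : A}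
    (he : IsIdempotentElem e) : D e = 0 := by
  have h : D e = e • D e + e • D e := by
    conv_lhs => rw [← he.eq]
    exact D.leibniz e e
  have h' : e • D e = 0 := by
    have := congrArg (e • ·) h
    simpa only [smul_add, ← mul_smul, he.eq, left_eq_add] using this
  rw [h, h', add_zero]

variable {k : Type u} [Field k] {A : Type u} [CommRing A] [Algebra k A]

theorem Algebra.etale_of_formallyUnramified (B : Type*) [CommRing B] [Algebra k B]
    [Algebra.FiniteType k B] [Algebra.FormallyUnramified k B] : Algebra.Etale k B where
  formallyEtale := .of_formallyUnramified_of_field k B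
  finitePresentation := Algebra.FinitePresentation.of_finiteType.mp inferInstance

theorem le_maxEtaleSubalgebra (B : Subalgebra k A) [h : Algebra.Etale k B] :
    B ≤ maxEtaleSubalgebra k A := le_sSup h

attribute [local instance] Algebra.TensorProduct.rightAlgebra in
/-- The coefficients of an idempotent of `K ⊗ A` generate an étale subalgebra of `A`. -/
theorem exists_etale_of_isIdempotentElem {K : Type*} [CommRing K] [Algebra k K]
    {e : K ⊗[k] A} (he : IsIdempotentElem e) :
    ∃ B : Subalgebra k A, Algebra.Etale k B ∧
      ∃ e' : K ⊗[k] B, Algebra.TensorProduct.map (AlgHom.id k K) B.val e' = e := by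
  classical
  let b := Module.Free.chooseBasis k K
  obtain ⟨f, hf⟩ := (TensorProduct.equivFinsuppOfBasisLeft b (N := A)).symm.surjective e
  let s : Finset A := f.support.image f
  let B := Algebra.adjoin k (s : Set A)
  have hmem (i) : f i ∈ B := by
    by_cases hi : f i = 0
    · rw [hi]; exact zero_mem _
    · exact Algebra.subset_adjoin (by
        simpa [s] using ⟨i, hi, rfl⟩)
  let g : Module.Free.ChooseBasisIndex k K →₀ B :=
    Finsupp.onFinset f.support (fun i ↦ ⟨f i, hmem i⟩) (by
      intro i hi
      simpa [Subtype.ext_iff] using hi)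
  let e' : K ⊗[k] B := (TensorProduct.equivFinsuppOfBasisLeft b (N := B)).symm g
  have he' : e' = g.sum fun i x ↦ b i ⊗ₜ x :=
    TensorProduct.equivFinsuppOfBasisLeft_symm_apply _ _
  have hinj : Function.Injective (Algebra.TensorProduct.map (AlgHom.id k K) B.val) :=
    Module.Flat.lTensor_preserves_injective_linearMap (M := K) B.val.toLinearMap
      Subtype.val_injective
  have hmap : Algebra.TensorProduct.map (AlgHom.id k K) B.val e' = e := by
    rw [← hf, TensorProduct.equivFinsuppOfBasisLeft_symm_apply, he', map_finsuppSum]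
    simp only [Algebra.TensorProduct.map_tmul, AlgHom.id_apply]
    rw [Finsupp.sum_of_support_subset (s := f.support) _ Finsupp.support_onFinset_subset _
      (by simp), Finsupp.sum]
    rfl
  have hidem : IsIdempotentElem e' := hinj (by rw [map_mul, hmap, he.eq])
  have hD := Derivation.apply_eq_zero_of_isIdempotentElem
    (KaehlerDifferential.D K (K ⊗[k] B)) hidem
  -- Under `K ⊗ Ω[B⁄k] ≃ Ω[(K ⊗ B)⁄K]`, the differential of `e'` is `∑ b i ⊗ D (g i)`; as `b` is a
  -- basis, its vanishing kills each `D (g i)`. These `g i` generate `B`, so `Ω[B⁄k] = 0`.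
  let ε := KaehlerDifferential.tensorKaehlerEquivBase k K B (K ⊗[k] B)
  have hε : ε ((TensorProduct.equivFinsuppOfBasisLeft b).symm
      (g.mapRange (KaehlerDifferential.D k B) (map_zero _))) = 0 := by
    rw [← hD, he', TensorProduct.equivFinsuppOfBasisLeft_symm_apply,
      Finsupp.sum_mapRange_index (by simp), map_finsuppSum, map_finsuppSum]
    refine Finsupp.sum_congr fun i _ ↦ ?_
    rw [KaehlerDifferential.tensorKaehlerEquivBase_tmul, KaehlerDifferential.map_D,
      ← (KaehlerDifferential.D K (K ⊗[k] B)).map_smul]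
    congr 1
    simp [Algebra.TensorProduct.right_algebraMap_apply, TensorProduct.smul_tmul']
  have hg : ∀ i, KaehlerDifferential.D k B (g i) = 0 := by
    rw [LinearEquiv.map_eq_zero_iff, LinearEquiv.map_eq_zero_iff] at hε
    exact fun i ↦ by simpa using DFunLike.congr_fun hε i
  have hgen : Algebra.adjoin k (Set.range g) = ⊤ := by
    have himg : B.val '' Set.range g ⊇ s := by
      intro x hx
      obtain ⟨i, _, rfl⟩ := Finset.mem_image.mp hx
      exact ⟨g i, ⟨i, rfl⟩, rfl⟩
    have h2 : B ≤ (Algebra.adjoin k (Set.range g)).map B.val := by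
      rw [AlgHom.map_adjoin]
      exact Algebra.adjoin_mono himg
    refine eq_top_iff.mpr fun x _ ↦ ?_
    obtain ⟨y, hy, hyx⟩ := h2 x.2
    rwa [← Subtype.ext hyx]
  have hunr : Algebra.FormallyUnramified k B := by
    refine ⟨?_⟩
    have hD0 : KaehlerDifferential.D k B = 0 :=
      Derivation.ext_of_adjoin_eq_top (Set.range g) hgen (by
        rintro _ ⟨i, rfl⟩
        simpa using hg i)
    have := KaehlerDifferential.span_range_derivation k B
    rw [hD0] at this
    refine subsingleton_of_forall_eq 0 fun x ↦ ?_
    have hx : x ∈ (⊤ : Submodule B (Ω[B⁄k])) := trivial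
    rw [← this] at hx
    refine (Submodule.mem_bot B).mp (Submodule.span_le.mpr ?_ hx)
    rintro _ ⟨y, rfl⟩
    simp
  have : Algebra.FiniteType k B := Subalgebra.fg_iff_finiteType _ |>.mp ⟨s, rfl⟩
  exact ⟨B, Algebra.etale_of_formallyUnramified B, e', hmap⟩

/-- Idempotents of `K ⊗ A` come from `K ⊗ π(A)`. -/
theorem exists_maxEtaleSubalgebra_of_isIdempotentElem {K : Type*} [CommRing K] [Algebra k K]
    {e : K ⊗[k] A} (he : IsIdempotentElem e) :
    ∃ e' : K ⊗[k] maxEtaleSubalgebra k A,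
      Algebra.TensorProduct.map (AlgHom.id k K) (maxEtaleSubalgebra k A).val e' = e := by
  obtain ⟨B, hB, e', rfl⟩ := exists_etale_of_isIdempotentElem he
  refine ⟨Algebra.TensorProduct.map (AlgHom.id k K)
    (Subalgebra.inclusion (le_maxEtaleSubalgebra B)) e', ?_⟩
  rw [← AlgHom.comp_apply, ← Algebra.TensorProduct.map_comp]
  rfl

/-! ### Finiteness of the largest étale subalgebra -/

theorem Algebra.finite_of_etale (B : Type*) [CommRing B] [Algebra k B] [Algebra.Etale k B] :
    Module.Finite k B :=
  Algebra.FormallyUnramified.finite_of_free k B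

/-- The join is a quotient of `B ⊗[k] C`, and quotients preserve unramifiedness, which over a field
suffices. -/
theorem etale_sup (B C : Subalgebra k A) [Algebra.Etale k B] [Algebra.Etale k C] :
    Algebra.Etale k ↥(B ⊔ C) := by
  let φ := Algebra.TensorProduct.productMap B.val C.val
  have hφ : φ.range = B ⊔ C := by
    rw [Algebra.TensorProduct.productMap_range, Subalgebra.range_val, Subalgebra.range_val]
  rw [← hφ]
  have : Algebra.FormallyUnramified k (B ⊗[k] C) := .comp k B _
  have : Algebra.FiniteType k (B ⊗[k] C) := .trans (S := B) inferInstance inferInstance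
  have := Algebra.FormallyUnramified.of_surjective φ.rangeRestrict φ.rangeRestrict_surjective
  have := Algebra.FiniteType.of_surjective φ.rangeRestrict φ.rangeRestrict_surjective
  exact Algebra.etale_of_formallyUnramified _

/-- The dimension of a finite étale subalgebra is at most the number of geometric irreducible
components. -/
theorem finrank_le_card_minimalPrimes (B A : Type u) [CommRing B] [CommRing A] [Algebra k B]
    [Algebra k A] [Algebra.Etale k B] [Algebra.FiniteType k A] (f : B →ₐ[k] A)
    (hf : Function.Injective f) :
    Module.finrank k B ≤ (minimalPrimes (AlgebraicClosure k ⊗[k] A)).ncard := by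
  let K := AlgebraicClosure k
  have : IsNoetherianRing (K ⊗[k] A) := Algebra.FiniteType.isNoetherianRing K _
  have hfin : (minimalPrimes (K ⊗[k] A)).Finite := minimalPrimes.finite_of_isNoetherianRing _
  have hB := Algebra.finite_of_etale (k := k) B
  have : IsArtinianRing (K ⊗[k] B) := isArtinian_of_tower K inferInstance
  have := Fintype.ofFinite (PrimeSpectrum (K ⊗[k] B))
  let φ := Algebra.TensorProduct.map (AlgHom.id k K) f
  have hinj : Function.Injective φ :=
    Module.Flat.lTensor_preserves_injective_linearMap (M := K) f.toLinearMap hf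
  have hrank : Module.finrank k B = Fintype.card (PrimeSpectrum (K ⊗[k] B)) := by
    rw [← Module.finrank_baseChange (R := K) (S := k) (M' := B),
      (Algebra.FormallyEtale.equivPiOfIsSepClosed K (K ⊗[k] B)).toLinearEquiv.finrank_eq,
      Module.finrank_fintype_fun_eq_card]
  -- `K ⊗ B` is a product of copies of `K`, so its rank counts its primes. All of them are minimal,
  -- hence contracted from minimal primes of the overring `K ⊗ A`.
  have hsurj : ∀ p : PrimeSpectrum (K ⊗[k] B), ∃ q ∈ minimalPrimes (K ⊗[k] A),
      q.comap φ = p.asIdeal := by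
    intro p
    refine Ideal.exists_minimalPrimes_comap_eq φ.toRingHom p.asIdeal ?_
    have : (⊥ : Ideal (K ⊗[k] A)).comap φ.toRingHom = ⊥ :=
      Ideal.comap_bot_of_injective φ.toRingHom hinj
    rw [this]
    refine ⟨⟨p.2, bot_le⟩, fun q hq hqp ↦ ?_⟩
    have := hq.1
    exact ((IsArtinianRing.isMaximal_of_isPrime q).eq_of_le p.2.ne_top hqp).ge
  choose q hq hqp using hsurj
  rw [hrank, ← Nat.card_eq_fintype_card, ← Set.ncard_univ]
  refine Set.ncard_le_ncard_of_injOn q (fun p _ ↦ hq p) (fun p _ p' _ h ↦ ?_) hfin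
  exact PrimeSpectrum.ext (by rw [← hqp, ← hqp, h])

/-- If `A` embeds into an algebra of finite type, then its largest étale subalgebra is étale. -/
theorem etale_maxEtaleSubalgebra {A' : Type u} [CommRing A'] [Algebra k A']
    [Algebra.FiniteType k A'] (f : A →ₐ[k] A') (hf : Function.Injective f) :
    Algebra.Etale k (maxEtaleSubalgebra k A) := by
  have hbound (B : Subalgebra k A) (hB : Algebra.Etale k B) :
      Module.finrank k B ≤ (minimalPrimes (AlgebraicClosure k ⊗[k] A')).ncard :=
    finrank_le_card_minimalPrimes B A' (f.comp B.val) (hf.comp Subtype.val_injective)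
  let S : Set ℕ := {n | ∃ B : Subalgebra k A, Algebra.Etale k B ∧ Module.finrank k B = n}
  have hS : S.Nonempty := by
    let φ := Algebra.ofId k A
    have := Algebra.FormallyUnramified.of_surjective φ.rangeRestrict φ.rangeRestrict_surjective
    have := Algebra.FiniteType.of_surjective φ.rangeRestrict φ.rangeRestrict_surjective
    exact ⟨_, φ.range, Algebra.etale_of_formallyUnramified _, rfl⟩
  have hS' : BddAbove S := ⟨_, by rintro _ ⟨B, hB, rfl⟩; exact hbound B hB⟩
  -- An étale subalgebra of maximal dimension absorbs every other one, since their join is again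
  -- étale.
  obtain ⟨B, hB, hBS⟩ := Nat.sSup_mem hS hS'
  have hmax : maxEtaleSubalgebra k A = B := by
    refine le_antisymm (sSup_le fun C hC ↦ ?_) (le_maxEtaleSubalgebra B)
    have hC : Algebra.Etale k C := hC
    have hsup := etale_sup C B
    have := Algebra.finite_of_etale (k := k) ↥(C ⊔ B)
    have hle : Module.finrank k ↥(C ⊔ B) ≤ Module.finrank k B := by
      rw [hBS]
      exact le_csSup hS' ⟨_, hsup, rfl⟩
    rw [Subalgebra.eq_of_le_of_finrank_le (le_sup_right : B ≤ C ⊔ B) hle]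
    exact le_sup_left
  rwa [hmax]

/-- Let `P` be an unramified `k`-algebra, `A` and `K` two `P`-algebras. If all idempotents of
`K ⊗[k] A` come from `K ⊗[k] P`, then all idempotents of `K ⊗[P] A` come from `K`. -/
theorem exists_algebraMap_eq_of_isIdempotentElem {P A K : Type*} [CommRing P] [CommRing A]
    [CommRing K] [Algebra k P] [Algebra k A] [Algebra k K] [Algebra P A] [Algebra P K]
    [IsScalarTower k P A] [IsScalarTower k P K] [Algebra.FormallyUnramified k P]
    [Algebra.EssFiniteType k P]
    (h : ∀ e : K ⊗[k] A, IsIdempotentElem e → ∃ e' : K ⊗[k] P,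
      Algebra.TensorProduct.map (AlgHom.id k K) (IsScalarTower.toAlgHom k P A) e' = e)
    {e : K ⊗[P] A} (he : IsIdempotentElem e) :
    ∃ x : K, algebraMap K (K ⊗[P] A) x = e := by
  let ρ : P ⊗[k] P →ₐ[k] K ⊗[k] A :=
    Algebra.TensorProduct.map (IsScalarTower.toAlgHom k P K) (IsScalarTower.toAlgHom k P A)
  -- The image of the separability idempotent of `P`. The two actions of `P` on `K ⊗[k] A` agree
  -- after multiplication by `ε`, so `σ` below is well defined and identifies `K ⊗[P] A` with the
  -- factor `ε (K ⊗[k] A)`; thus `ε * y` is an idempotent lift of `q y = e`.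
  let ε : K ⊗[k] A := ρ (Algebra.FormallyUnramified.elem k P)
  let q : K ⊗[k] A →ₐ[k] K ⊗[P] A :=
    Algebra.TensorProduct.lift
      ((Algebra.TensorProduct.includeLeft : K →ₐ[P] K ⊗[P] A).restrictScalars k)
      ((Algebra.TensorProduct.includeRight : A →ₐ[P] K ⊗[P] A).restrictScalars k)
      (fun _ _ ↦ Commute.all _ _)
  have hqt (x : K) (a : A) : q (x ⊗ₜ a) = x ⊗ₜ a := by simp [q]
  have hε (p : P) : (1 ⊗ₜ algebraMap P A p) * ε = (algebraMap P K p ⊗ₜ 1) * ε := by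
    have := congrArg ρ (Algebra.FormallyUnramified.one_tmul_mul_elem (R := k) p)
    simpa [ρ, ε] using this
  have hqε : q ε = 1 := by
    have : q.comp ρ = ((Algebra.ofId P (K ⊗[P] A)).restrictScalars k).comp
        (Algebra.TensorProduct.lmul' k) := by
      ext x
      · simp [ρ, q, Algebra.ofId_apply, Algebra.TensorProduct.algebraMap_apply]
      · simp [ρ, q, Algebra.ofId_apply, Algebra.TensorProduct.algebraMap_apply,
          Algebra.TensorProduct.tmul_one_eq_one_tmul]
    have := DFunLike.congr_fun this (Algebra.FormallyUnramified.elem k P)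
    simpa [Algebra.FormallyUnramified.lmul_elem, Algebra.TensorProduct.one_def] using this
  let σ : K ⊗[P] A →+ K ⊗[k] A := TensorProduct.liftAddHom
    (AddMonoidHom.mk' (fun x ↦ AddMonoidHom.mk' (fun a ↦ ε * (x ⊗ₜ a))
      fun a b ↦ by rw [TensorProduct.tmul_add, mul_add])
      fun x y ↦ by ext a; simp [TensorProduct.add_tmul, mul_add]) (by
    intro p x a
    have h₁ : (p • x) ⊗ₜ[k] a = (algebraMap P K p ⊗ₜ 1) * (x ⊗ₜ[k] a) := by
      rw [Algebra.TensorProduct.tmul_mul_tmul, Algebra.smul_def, one_mul]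
    have h₂ : x ⊗ₜ[k] (p • a) = (1 ⊗ₜ algebraMap P A p) * (x ⊗ₜ[k] a) := by
      rw [Algebra.TensorProduct.tmul_mul_tmul, Algebra.smul_def, one_mul]
    simp only [AddMonoidHom.mk'_apply, h₁, h₂]
    rw [← mul_assoc, ← mul_assoc, mul_comm ε, mul_comm ε, hε])
  have hσ (x : K ⊗[k] A) : σ (q x) = ε * x := by
    induction x with
    | zero => simp
    | tmul x a => rw [hqt]; rfl
    | add x y hx hy => rw [map_add, map_add, hx, hy, mul_add]
  have hεε : ε * ε = ε := by
    rw [← hσ, hqε, ← map_one q, hσ, mul_one]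
  have hq : Function.Surjective q := by
    intro z
    induction z with
    | zero => exact ⟨0, map_zero _⟩
    | tmul x a => exact ⟨_, hqt x a⟩
    | add x y hx hy =>
      obtain ⟨x, rfl⟩ := hx
      obtain ⟨y, rfl⟩ := hy
      exact ⟨x + y, map_add q x y⟩
  obtain ⟨y, rfl⟩ := hq e
  have hy : IsIdempotentElem (ε * y) := by
    have : ε * (y * y) = ε * y := by rw [← hσ, ← hσ, map_mul, he.eq]
    rw [IsIdempotentElem, mul_mul_mul_comm, hεε, this]
  obtain ⟨z, hz⟩ := h _ hy
  rw [← one_mul (q y), ← hqε, ← map_mul, ← hz]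
  clear hz hy he
  induction z with
  | zero => exact ⟨0, by simp⟩
  | tmul x p =>
    refine ⟨x * algebraMap P K p, ?_⟩
    simp only [Algebra.TensorProduct.map_tmul, hqt, AlgHom.id_apply,
      IsScalarTower.coe_toAlgHom', Algebra.TensorProduct.algebraMap_apply, Algebra.algebraMap_self,
      RingHom.id_apply]
    rw [mul_comm, ← Algebra.smul_def, TensorProduct.smul_tmul, Algebra.smul_def, mul_one]
  | add z w hz hw =>
    obtain ⟨x, hx⟩ := hz
    obtain ⟨y, hy⟩ := hw
    exact ⟨x + y, by rw [map_add, map_add, map_add, hx, hy]⟩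

end Algebra
end

/-! ### Geometric connectedness of `γ`. -/

section

open scoped TensorProduct
open Limits

/-- A nonempty scheme whose ring of global functions has no nontrivial idempotents is connected. -/
theorem connectedSpace_of_isIdempotentElem (X : Scheme.{u}) [Nonempty X]
    (h : ∀ e : Γ(X, ⊤), IsIdempotentElem e → e = 0 ∨ e = 1) : ConnectedSpace X := by
  refine @ConnectedSpace.mk _ _ (preconnectedSpace_iff_clopen.mpr fun s hs ↦ ?_) inferInstance
  let U : Bool → X.Opens := fun b ↦ cond b ⟨s, hs.isOpen⟩ ⟨sᶜ, hs.compl.isOpen⟩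
  have hcov : (⊤ : X.Opens) ≤ iSup U := by
    intro x _
    by_cases hx : x ∈ s
    · exact TopologicalSpace.Opens.mem_iSup.mpr ⟨true, hx⟩
    · exact TopologicalSpace.Opens.mem_iSup.mpr ⟨false, hx⟩
  -- These sections glue to an idempotent. If it is `0` or `1`, then `0 = 1` on one of the two
  -- pieces, which is therefore empty.
  let sf : ∀ b, Γ(X, U b) := fun b ↦ cond b 1 0
  have hempty : ∀ b c, b ≠ c → U b ⊓ U c = ⊥ := by
    intro b c hbc
    ext x
    cases b <;> cases c <;> simp [U] at hbc ⊢
  have hsf : TopCat.Presheaf.IsCompatible X.sheaf.1 U sf := by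
    intro b c
    by_cases hbc : b = c
    · subst hbc; rfl
    · have : Subsingleton Γ(X, U b ⊓ U c) := by
        rw [hempty b c hbc]; infer_instance
      exact Subsingleton.elim (α := Γ(X, U b ⊓ U c)) _ _
  obtain ⟨e, h1⟩ : ∃ e : Γ(X, ⊤), ∀ b,
      X.presheaf.map (homOfLE le_top : U b ⟶ ⊤).op e = sf b :=
    (X.sheaf.existsUnique_gluing' U ⊤ (fun b ↦ homOfLE le_top) hcov sf hsf).exists
  have hidem : IsIdempotentElem e := by
    refine X.sheaf.eq_of_locally_eq' U ⊤ (fun b ↦ homOfLE le_top) hcov _ _ fun b ↦ ?_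
    have : X.presheaf.map (homOfLE le_top : U b ⟶ ⊤).op (e * e) =
      X.presheaf.map (homOfLE le_top : U b ⟶ ⊤).op e := by
      rw [map_mul, h1 b]
      cases b <;> simp [sf]
    exact this
  have key (b : Bool) (h01 : (0 : Γ(X, U b)) = 1) : U b = ⊥ := by
    rw [← X.basicOpen_of_isUnit (f := (1 : Γ(X, U b))) isUnit_one, ← h01, Scheme.basicOpen_zero]
  rcases h e hidem with rfl | rfl
  · left
    have := h1 true
    rw [map_zero] at this
    exact congrArg (fun V : X.Opens ↦ (V : Set X)) (key true this)
  · right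
    have := h1 false
    rw [map_one] at this
    have := congrArg (fun V : X.Opens ↦ (V : Set X)) (key false this.symm)
    exact Set.compl_empty_iff.mp this

theorem appLE_top {X Y : Scheme.{u}} (f : X ⟶ Y) (h : (⊤ : X.Opens) ≤ f ⁻¹ᵁ ⊤) :
    f.appLE ⊤ ⊤ h = f.appTop := f.appLE_eq_app

variable {k : Type u} [Field k]

/-- `𝒪(X)` need not be of finite type, but by quasi-compactness it embeds into the functions on a
finite disjoint union of affine opens, which are. -/
theorem etale_maxEtaleSubalgebra_globalFunctions (X : Over (Spec (.of k)))
    [LocallyOfFiniteType X.hom] [QuasiCompact X.hom] :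
    Algebra.Etale k (maxEtaleSubalgebra k (GlobalFunctions X)) := by
  have : CompactSpace X.left := QuasiCompact.compactSpace_of_compactSpace X.hom
  let 𝒰 := X.left.affineCover.finiteSubcover
  let p : (∐ 𝒰.X) ⟶ X.left := Sigma.desc 𝒰.f
  have : IsZariskiLocalAtSource @LocallyOfFiniteType :=
    HasRingHomProperty.instIsZariskiLocalAtSource (Q := RingHom.FiniteType)
  have : LocallyOfFiniteType p := IsZariskiLocalAtSource.sigmaDesc (fun _ ↦ inferInstance)
  let Y : Over (Spec (.of k)) := Over.mk (p ≫ X.hom)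
  have : IsAffine Y.left := inferInstanceAs (IsAffine (∐ 𝒰.X))
  let f : GlobalFunctions X →ₐ[k] GlobalFunctions Y :=
    { toRingHom := p.appTop.hom
      commutes' := fun r ↦ by
        change p.appTop.hom (((Scheme.ΓSpecIso (.of k)).inv ≫ X.hom.appTop).hom r) =
          ((Scheme.ΓSpecIso (.of k)).inv ≫ (p ≫ X.hom).appTop).hom r
        rw [Scheme.Hom.comp_appTop]; rfl }
  have hf : Function.Injective f := by
    refine (injective_iff_map_eq_zero f).mpr fun a ha ↦ ?_
    refine Scheme.zero_of_zero_cover (X := X.left) (U := ⊤) a 𝒰 fun i ↦ ?_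
    have h1 : 𝒰.f i = Sigma.ι 𝒰.X i ≫ p := by simp [p]
    have h2 : (p.app ⊤).hom a = 0 := ha
    have h3 : ((Sigma.ι 𝒰.X i ≫ p).app ⊤).hom a = 0 := by
      rw [Scheme.Hom.comp_app]
      exact (congrArg ((Sigma.ι 𝒰.X i).app (p ⁻¹ᵁ ⊤)).hom h2).trans (map_zero _)
    rw [h1]
    exact h3
  have : Algebra.FiniteType k (GlobalFunctions Y) := by
    have : LocallyOfFiniteType Y.hom := inferInstanceAs (LocallyOfFiniteType (p ≫ X.hom))
    have h := (HasRingHomProperty.iff_of_isAffine (P := @LocallyOfFiniteType)).mp this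
    have h' : ((Scheme.ΓSpecIso (.of k)).inv ≫ Y.hom.appTop).hom.FiniteType := by
      rw [CommRingCat.hom_comp]
      exact h.comp (RingHom.FiniteType.of_surjective _
        (Scheme.ΓSpecIso (.of k)).symm.commRingCatIsoToRingEquiv.surjective)
    exact h'
  exact etale_maxEtaleSubalgebra f hf

/-- Cancellation through the graph of `f`, a base change of the diagonal of `g`, which is an open
immersion and so flat. -/
theorem flat_of_flat_comp {X Y Z : Scheme.{u}} (f : X ⟶ Y) (g : Y ⟶ Z)
    [Flat (f ≫ g)] [hg : Etale g] : Flat f := by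
  have := (MorphismProperty.hasOfPostcompProperty_iff_le_diagonal (P := @Flat) (Q := @Etale)).mpr
    fun X Y f (hf : Etale f) ↦ (inferInstance : Flat (pullback.diagonal f))
  exact this.of_postcomp f g hg ‹_›

theorem ΓSpecIso_inv_comp_appTop_toPiZero_left (X : Over (Spec (.of k))) :
    (Scheme.ΓSpecIso (.of (maxEtaleSubalgebra k (GlobalFunctions X)))).inv ≫
      (toPiZero X).left.appTop = piZeroInclusion X := by
  change _ ≫ (X.left.toSpecΓ ≫ Spec.map (piZeroInclusion X)).appTop = _
  simp

section PiZero

variable (X : Over (Spec (.of k))) [LocallyOfFiniteType X.hom] [QuasiCompact X.hom]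

theorem etale_piZero_hom : Etale (piZero X).hom := by
  have := etale_maxEtaleSubalgebra_globalFunctions X
  exact HasRingHomProperty.Spec_iff.mpr (RingHom.etale_algebraMap.mpr this)

theorem isFinite_piZero_hom : IsFinite (piZero X).hom := by
  have := etale_maxEtaleSubalgebra_globalFunctions X
  have := Algebra.finite_of_etale (k := k) (maxEtaleSubalgebra k (GlobalFunctions X))
  exact (IsFinite.SpecMap_iff _).mpr (RingHom.finite_algebraMap.mpr this)

theorem quasiCompact_toPiZero_left : QuasiCompact (toPiZero X).left := by
  have : QuasiCompact ((toPiZero X).left ≫ (piZero X).hom) := by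
    rw [Over.w]; infer_instance
  have := isFinite_piZero_hom X
  exact .of_comp _ (piZero X).hom

theorem flat_toPiZero_left : Flat (toPiZero X).left := by
  have : Flat ((toPiZero X).left ≫ (piZero X).hom) := by
    rw [Over.w]; infer_instance
  have := etale_piZero_hom X
  exact flat_of_flat_comp _ (piZero X).hom

theorem geometricallyConnected_toPiZero_left : GeometricallyConnected (toPiZero X).left := by
  have hét := etale_maxEtaleSubalgebra_globalFunctions X
  let A := GlobalFunctions X
  let P := maxEtaleSubalgebra k A
  let f : X.left ⟶ Spec (.of P) := (toPiZero X).left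
  have : CompactSpace X.left := QuasiCompact.compactSpace_of_compactSpace X.hom
  have : IsLocallyNoetherian X.left := LocallyOfFiniteType.isLocallyNoetherian X.hom
  refine ⟨(geometrically_iff_of_commRing_of_isClosedUnderIsomorphisms (R := P) (f := f)).mpr
    fun K _ _ ↦ ?_⟩
  let : Algebra k K := ((algebraMap P K).comp (algebraMap k P)).toAlgebra
  have : IsScalarTower k P K := .of_algebraMap_eq' rfl
  have : Module.Flat P K := Algebra.FormallyUnramified.flat_of_restrictScalars k P K
  let φ : CommRingCat.of P ⟶ .of K := CommRingCat.ofHom (algebraMap P K)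
  have : Flat (Spec.map φ) := HasRingHomProperty.Spec_iff.mpr (RingHom.flat_algebraMap_iff.mpr this)
  let Z := pullback f (Spec.map φ)
  -- Flat base change: `X` is quasi-compact and quasi-separated, and `K` is flat over `P`, so the
  -- functions on the fibre `Z` are `K ⊗[P] A`.
  have hiso : IsIso (pushoutSection (IsPullback.of_hasPullback f (Spec.map φ)) (US := ⊤) (UT := ⊤)
      (UX := ⊤) (UY := ⊤) le_top le_top (by simp)) := by
    apply isIso_pushoutSection_of_isQuasiSeparated_of_flat_right
    · exact isAffineOpen_top _
    · exact isAffineOpen_top _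
    · exact isCompact_univ
    · exact isQuasiSeparated_univ
  have hpo := (isIso_pushoutSection_iff ..).mp hiso
  have hpo' : IsPushout (piZeroInclusion X) φ (pullback.fst f (Spec.map φ)).appTop
      ((Scheme.ΓSpecIso (.of K)).inv ≫ (pullback.snd f (Spec.map φ)).appTop) := by
    refine .of_iso hpo (Scheme.ΓSpecIso _) (Iso.refl _) (Scheme.ΓSpecIso _) (Iso.refl _) ?_ ?_ ?_ ?_
    · refine (Category.comp_id _).trans ((appLE_top f _).trans ?_)
      exact (Scheme.ΓSpecIso (.of P)).inv_comp_eq.mp (ΓSpecIso_inv_comp_appTop_toPiZero_left X)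
    · exact (congrArg (· ≫ _) (appLE_top (Spec.map φ) _)).trans (Scheme.ΓSpecIso_naturality φ)
    · exact (Category.comp_id _).trans ((appLE_top _ _).trans (Category.id_comp _).symm)
    · refine (Category.comp_id _).trans ((appLE_top _ _).trans ?_)
      exact (Iso.hom_inv_id_assoc _ _).symm
  let ψ : K ⊗[P] A ≃+* Γ(Z, ⊤) :=
    ((CommRingCat.isPushout_tensorProduct P K A).flip.isoIsPushout _ _ hpo').commRingCatIsoToRingEquiv
  have hinj : Function.Injective (algebraMap K (K ⊗[P] A)) := by
    have h1 := Module.Flat.lTensor_preserves_injective_linearMap (M := K)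
      (Algebra.linearMap P A) Subtype.val_injective
    have h2 : (algebraMap K (K ⊗[P] A) : K → K ⊗[P] A) =
        (Algebra.linearMap P A).lTensor K ∘ (TensorProduct.rid P K).symm := by
      ext x; simp [Algebra.TensorProduct.algebraMap_apply]
    rw [h2]
    exact h1.comp (TensorProduct.rid P K).symm.injective
  have : Nontrivial (K ⊗[P] A) := hinj.nontrivial
  have : Nontrivial Γ(Z, ⊤) := ψ.injective.nontrivial
  have : Nonempty Z := by
    by_contra h
    rw [not_nonempty_iff] at h
    exact not_subsingleton Γ(Z, ⊤) inferInstance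
  refine connectedSpace_of_isIdempotentElem Z fun e he ↦ ?_
  obtain ⟨x, hx⟩ := exists_algebraMap_eq_of_isIdempotentElem (k := k) (P := P) (A := A) (K := K)
    (fun e he ↦ exists_maxEtaleSubalgebra_of_isIdempotentElem he) (e := ψ.symm e) (he.map ψ.symm)
  have hx' : IsIdempotentElem x := hinj (by rw [map_mul, hx, (he.map ψ.symm).eq])
  rcases IsIdempotentElem.iff_eq_zero_or_one.mp hx' with rfl | rfl
  · left
    rw [← ψ.apply_symm_apply e, ← hx, map_zero, map_zero]
  · right
    rw [← ψ.apply_symm_apply e, ← hx, map_one, map_one]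

end PiZero

theorem locallyQuasiFinite_of_formallyUnramified {X Y : Scheme.{u}} (f : X ⟶ Y)
    [FormallyUnramified f] [LocallyOfFiniteType f] : LocallyQuasiFinite f := by
  refine HasRingHomProperty.iff_appLE.mpr fun U V e ↦ ?_
  have h1 := (HasRingHomProperty.iff_appLE (P := @FormallyUnramified)).mp ‹_› U V e
  have h2 := (HasRingHomProperty.iff_appLE (P := @LocallyOfFiniteType)).mp ‹_› U V e
  algebraize [(f.appLE U V e).hom]
  exact inferInstanceAs (Algebra.QuasiFinite _ _)

/-- A scheme étale over a field has the discrete topology. -/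
theorem discreteTopology_of_etale {X : Scheme.{u}} (f : X ⟶ Spec (.of k)) [Etale f] :
    DiscreteTopology X := by
  have := locallyQuasiFinite_of_formallyUnramified f
  have : IsLocallyArtinian X := .of_locallyQuasiFinite f
  infer_instance

end

/-! ### Rigidity of morphisms to étale schemes, and descent along `γ`. -/

section
open Limits
variable {k : Type u} [Field k]

/-- Two morphisms into an étale `k`-scheme agree as soon as every point lies in a connected subset
containing a point where they agree. -/
theorem eq_of_isPreconnected {D Y H : Scheme.{u}} (h : H ⟶ Spec (.of k)) [Etale h] (f g : Y ⟶ H)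
    (hfg : f ≫ h = g ≫ h) (q : D ⟶ Y) (hq : q ≫ f = q ≫ g)
    (hconn : ∀ y : Y, ∃ T : Set Y, _root_.IsPreconnected T ∧ y ∈ T ∧ (T ∩ Set.range q).Nonempty) :
    f = g := by
  obtain ⟨l, hlf, hlg⟩ : ∃ l : Y ⟶ pullback h h,
      l ≫ pullback.fst h h = f ∧ l ≫ pullback.snd h h = g :=
    ⟨pullback.lift f g hfg, pullback.lift_fst .., pullback.lift_snd ..⟩
  have : DiscreteTopology ↥(pullback h h) := discreteTopology_of_etale (pullback.fst h h ≫ h)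
  -- The equalizer of `f` and `g`. Its image is clopen because `H × H` is discrete. It is an open
  -- immersion because `h` is unramified, so surjectivity gives equality of morphisms even when `Y`
  -- is not reduced.
  let ι := pullback.fst l (pullback.diagonal h)
  have hι : ι ≫ l = pullback.snd l (pullback.diagonal h) ≫ pullback.diagonal h :=
    pullback.condition
  have hιf : ι ≫ f = pullback.snd l (pullback.diagonal h) := by
    rw [← hlf, reassoc_of% hι, pullback.diagonal_fst, Category.comp_id]
  have hιg : ι ≫ g = pullback.snd l (pullback.diagonal h) := by
    rw [← hlg, reassoc_of% hι, pullback.diagonal_snd, Category.comp_id]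
  have hrange : Set.range ι = l ⁻¹' Set.range (pullback.diagonal h) :=
    Scheme.Pullback.range_fst _ _
  have hclopen : IsClopen (Set.range ι) := by
    rw [hrange]
    exact (isClopen_discrete _).preimage l.continuous
  have hsub : Set.range q ⊆ Set.range ι := by
    have hql : q ≫ l = (q ≫ f) ≫ pullback.diagonal h := by
      refine pullback.hom_ext ?_ ?_
      · rw [Category.assoc, Category.assoc, hlf, pullback.diagonal_fst, Category.comp_id]
      · rw [Category.assoc, Category.assoc, hlg, pullback.diagonal_snd, Category.comp_id, hq]
    rintro _ ⟨x, rfl⟩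
    refine ⟨pullback.lift q (q ≫ f) hql x, ?_⟩
    rw [← Scheme.Hom.comp_apply, pullback.lift_fst]
  have hsurj : Surjective ι := ⟨fun y ↦ by
    obtain ⟨T, hT, hyT, hne⟩ := hconn y
    exact hT.subset_isClopen hclopen (hne.mono (Set.inter_subset_inter_right _ hsub)) hyT⟩
  have : IsIso ι := (isIso_iff_isOpenImmersion_and_surjective ι).mpr ⟨inferInstance, hsurj⟩
  rw [← cancel_epi ι, hιf, hιg]

theorem isPullback_whiskerRight {X Y : Over (Spec (.of k))} (φ : X ⟶ Y) (S : Over (Spec (.of k))) :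
    IsPullback (φ ▷ S).left (pullback.fst X.hom S.hom) (pullback.fst Y.hom S.hom) φ.left := by
  refine IsPullback.of_right (h₁₂ := pullback.snd Y.hom S.hom) (h₂₂ := Y.hom) (v₁₃ := S.hom) ?_
    (Over.whiskerRight_left_fst _) (IsPullback.of_hasPullback _ _).flip
  have h := (IsPullback.of_hasPullback X.hom S.hom).flip
  have e : (φ ▷ S).left ≫ pullback.snd Y.hom S.hom = pullback.snd X.hom S.hom :=
    Over.whiskerRight_left_snd _
  rw [e, Over.w φ]
  exact h

section

variable (X : Over (Spec (.of k))) [LocallyOfFiniteType X.hom] [QuasiCompact X.hom]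
  (H : Over (Spec (.of k))) [Etale H.hom]

theorem bijective_toPiZero_whiskerRight_comp (S : Over (Spec (.of k))) :
    Function.Bijective fun f : piZero X ⊗ S ⟶ H ↦ (toPiZero X ▷ S) ≫ f := by
  let p := (toPiZero X ▷ S).left
  have hpb := isPullback_whiskerRight (toPiZero X) S
  have h1 := flat_toPiZero_left X
  have h2 := quasiCompact_toPiZero_left X
  have h3 := geometricallyConnected_toPiZero_left X
  have : Flat p := MorphismProperty.of_isPullback hpb.flip h1
  have : QuasiCompact p := MorphismProperty.of_isPullback hpb.flip h2
  have : GeometricallyConnected p := MorphismProperty.of_isPullback hpb.flip h3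
  have : Surjective p := inferInstance
  have : EffectiveEpi p := inferInstance
  have : Epi p := inferInstance
  constructor
  · intro f g hfg
    ext : 1
    rw [← cancel_epi p]
    exact congrArg (·.left) hfg
  · intro f
    have hf : pullback.fst p p ≫ f.left = pullback.snd p p ≫ f.left := by
      refine eq_of_isPreconnected H.hom _ _ ?_ (pullback.diagonal p) (by simp) fun y ↦ ?_
      · have := pullback.condition (f := p) (g := p) =≫ (piZero X ⊗ S).hom
        simpa [p, Over.w] using this
      -- The fibre of the first projection through `y` is a base change of a fibre of `p`, hence
      -- connected, and it meets the diagonal.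
      · refine ⟨_, ((pullback.fst p p).isConnected_preimage_singleton
          (pullback.fst p p y)).isPreconnected, rfl, ?_⟩
        refine ⟨pullback.diagonal p (pullback.fst p p y), ?_, ⟨_, rfl⟩⟩
        rw [Set.mem_preimage, ← Scheme.Hom.comp_apply, pullback.diagonal_fst]
        rfl
    obtain ⟨d, hd⟩ := IsRegularEpi.exists_of_isKernelPair p (IsPullback.of_hasPullback p p)
      f.left hf
    refine ⟨Over.homMk d ?_, ?_⟩
    · rw [← cancel_epi p, reassoc_of% hd, Over.w]
      exact (Over.w (toPiZero X ▷ S)).symm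
    · ext : 1
      exact hd

theorem isIso_homFunctorPullback_toPiZero [GrpObj H] :
    IsIso (homFunctorPullback (toPiZero X) H) := by
  have (S : (Over (Spec (.of k)))ᵒᵖ) : IsIso ((homFunctorPullback (toPiZero X) H).app S) := by
    have : Function.Bijective ((homFunctorPullback (toPiZero X) H).app S) :=
      bijective_toPiZero_whiskerRight_comp X H S.unop
    exact (ConcreteCategory.isIso_iff_bijective _).mpr this
  exact NatIso.isIso_of_isIso_app _

end
end

/-! ### Weil restriction along a finite free algebra. -/

section

open scoped TensorProduct

section WeilRestriction

/-- The `i`-th coefficient of an element of `A ⊗ C` with respect to a basis of `A`. -/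
def tensorCoeff {k A C ι : Type*} [CommRing k] [CommRing A] [CommRing C] [Algebra k A]
    [Algebra k C] (b : Module.Basis ι k A) (i : ι) : A ⊗[k] C →ₗ[k] C :=
  (TensorProduct.lid k C).toLinearMap ∘ₗ (b.coord i).rTensor C

section

variable {k A C D ι : Type*} [CommRing k] [CommRing A] [CommRing C] [CommRing D] [Algebra k A]
  [Algebra k C] [Algebra k D] (b : Module.Basis ι k A)

theorem tensorCoeff_map (i : ι) (φ : C →ₐ[k] D) (z : A ⊗[k] C) :
    tensorCoeff b i (Algebra.TensorProduct.map (AlgHom.id k A) φ z) = φ (tensorCoeff b i z) := by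
  induction z with
  | zero => simp
  | tmul a c => simp [tensorCoeff]
  | add x y hx hy => simp only [map_add, hx, hy]

theorem sum_tmul_tensorCoeff [Fintype ι] (z : A ⊗[k] C) : ∑ i, b i ⊗ₜ[k] tensorCoeff b i z = z := by
  induction z with
  | zero => simp
  | tmul a c =>
    conv_rhs => rw [← b.sum_repr a, TensorProduct.sum_tmul]
    simp [tensorCoeff, TensorProduct.smul_tmul]
  | add x y hx hy => simp only [map_add, TensorProduct.tmul_add, Finset.sum_add_distrib, hx, hy]

theorem ext_tensorCoeff [Fintype ι] {z w : A ⊗[k] C} (h : ∀ i, tensorCoeff b i z = tensorCoeff b i w) :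
    z = w := by
  rw [← sum_tmul_tensorCoeff b z, ← sum_tmul_tensorCoeff b w]
  simp only [h]

theorem tensorCoeff_sum_tmul [Fintype ι] (c : ι → C) (i : ι) :
    tensorCoeff b i (∑ j, b j ⊗ₜ[k] c j) = c i := by
  classical
  simp [tensorCoeff, Finsupp.single_apply]

end

variable {k : Type u} [CommRing k] (A B : Type u) [CommRing A] [CommRing B] [Algebra k A]
  [Algebra k B]

variable {A} in
/-- The generic `k`-linear-coefficient map `B → A ⊗ k[X]`. -/
def genericMap {ι : Type u} [Fintype ι] (b : Module.Basis ι k A) (x : B) :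
    A ⊗[k] MvPolynomial (B × ι) k :=
  ∑ i, b i ⊗ₜ MvPolynomial.X (x, i)

variable {A} in
/-- The elements of `A ⊗ k[X]` whose vanishing makes the generic map a homomorphism of algebras. -/
inductive GenericRelation {ι : Type u} [Fintype ι] (b : Module.Basis ι k A) :
    A ⊗[k] MvPolynomial (B × ι) k → Prop
  | add (x y : B) : GenericRelation b
      (genericMap B b (x + y) - (genericMap B b x + genericMap B b y))
  | mul (x y : B) : GenericRelation b
      (genericMap B b (x * y) - genericMap B b x * genericMap B b y)
  | algebraMap (c : k) : GenericRelation b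
      (genericMap B b (algebraMap k B c) - algebraMap k _ c)

/-- The Weil restriction of the affine scheme `Spec (A ⊗ B)` along a finite free algebra `A`. -/
theorem exists_weilRestriction [Module.Free k A] [Module.Finite k A] :
    ∃ (R : Type u) (_ : CommRing R) (_ : Algebra k R) (υ : B →ₐ[k] A ⊗[k] R),
      (Module.Finite k B → Algebra.FiniteType k R) ∧
      ∀ (C : Type u) [CommRing C] [Algebra k C], Function.Bijective fun φ : R →ₐ[k] C ↦
        (Algebra.TensorProduct.map (AlgHom.id k A) φ).comp υ := by
  classical
  let ι := Module.Free.ChooseBasisIndex k A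
  let b : Module.Basis ι k A := Module.Free.chooseBasis k A
  let P := MvPolynomial (B × ι) k
  let J : Ideal P := Ideal.span {p | ∃ z, GenericRelation B b z ∧ ∃ i, tensorCoeff b i z = p}
  let R := P ⧸ J
  let μ : A ⊗[k] P →ₐ[k] A ⊗[k] R :=
    Algebra.TensorProduct.map (AlgHom.id k A) (Ideal.Quotient.mkₐ k J)
  have hμ (z) (hz : GenericRelation B b z) : μ z = 0 := ext_tensorCoeff b fun i ↦ by
    rw [tensorCoeff_map, map_zero, Ideal.Quotient.mkₐ_eq_mk, Ideal.Quotient.eq_zero_iff_mem]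
    exact Ideal.subset_span ⟨z, hz, i, rfl⟩
  have hadd (x y) : μ (genericMap B b (x + y)) = μ (genericMap B b x) + μ (genericMap B b y) := by
    simpa [sub_eq_zero] using hμ _ (.add x y)
  have hmul (x y) : μ (genericMap B b (x * y)) = μ (genericMap B b x) * μ (genericMap B b y) := by
    simpa [sub_eq_zero] using hμ _ (.mul x y)
  have halg (c : k) : μ (genericMap B b (algebraMap k B c)) = Algebra.ofId k (A ⊗[k] R) c := by
    have := hμ _ (.algebraMap c)
    rwa [map_sub, sub_eq_zero, AlgHom.commutes] at this
  let υ : B →ₐ[k] A ⊗[k] R :=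
    { toFun := fun x ↦ μ (genericMap B b x)
      map_add' := hadd
      map_mul' := hmul
      map_zero' := by simpa using halg 0
      map_one' := by simpa using halg 1
      commutes' := halg }
  have hυ (x i) : tensorCoeff b i (υ x) = Ideal.Quotient.mkₐ k J (MvPolynomial.X (x, i)) := by
    change tensorCoeff b i (μ _) = _
    rw [tensorCoeff_map, genericMap, tensorCoeff_sum_tmul]
  refine ⟨R, inferInstance, inferInstance, υ, fun hB ↦ ?_, fun C _ _ ↦ ⟨fun φ ψ h ↦ ?_, fun θ ↦ ?_⟩⟩
  -- There is a variable for every element of `B`, but the coefficients of `υ x` are `k`-linear in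
  -- `x`, so those of a finite spanning set of `B` generate `R`.
  · obtain ⟨s, hs⟩ := hB.fg_top
    let T : Set R := Set.range fun xi : s × ι ↦ tensorCoeff b xi.2 (υ xi.1)
    have hT : Algebra.adjoin k T = ⊤ := by
      have hmem (x i) : tensorCoeff b i (υ x) ∈ Algebra.adjoin k T := by
        have hx : x ∈ Submodule.span k (s : Set B) := hs ▸ trivial
        have hle : Submodule.span k (s : Set B) ≤ (Subalgebra.toSubmodule (Algebra.adjoin k T)).comap
            (tensorCoeff b i ∘ₗ υ.toLinearMap) := Submodule.span_le.mpr fun y hy ↦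
          Algebra.subset_adjoin ⟨(⟨y, hy⟩, i), rfl⟩
        exact hle hx
      refine eq_top_iff.mpr fun r _ ↦ ?_
      obtain ⟨p, rfl⟩ := Ideal.Quotient.mkₐ_surjective k J r
      induction p using MvPolynomial.induction_on with
      | C c => exact Subalgebra.algebraMap_mem _ c
      | add p q hp hq => rw [map_add]; exact add_mem (hp trivial) (hq trivial)
      | mul_X p xi hp => rw [map_mul, ← hυ]; exact mul_mem (hp trivial) (hmem _ _)
    have hfin : T.Finite := Set.finite_range _
    exact ⟨⟨hfin.toFinset, by simpa using hT⟩⟩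
  · refine Ideal.Quotient.algHom_ext k (MvPolynomial.algHom_ext fun xi ↦ ?_)
    have := congrArg (tensorCoeff b xi.2) (DFunLike.congr_fun h xi.1)
    simpa [tensorCoeff_map, hυ] using this
  · let φ₀ : P →ₐ[k] C := MvPolynomial.aeval fun xi : B × ι ↦ tensorCoeff b xi.2 (θ xi.1)
    have hφ₀ (x) : Algebra.TensorProduct.map (AlgHom.id k A) φ₀ (genericMap B b x) = θ x :=
      ext_tensorCoeff b fun i ↦ by
        rw [tensorCoeff_map, genericMap, tensorCoeff_sum_tmul]
        exact MvPolynomial.aeval_X _ _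
    have hJ : ∀ p ∈ J, φ₀ p = 0 := by
      have hle : J ≤ RingHom.ker φ₀ := by
        refine Ideal.span_le.mpr ?_
        rintro _ ⟨z, hz, i, rfl⟩
        rw [SetLike.mem_coe, RingHom.mem_ker, ← tensorCoeff_map]
        cases hz <;> simp [hφ₀]
      exact fun p hp ↦ hle hp
    let φ : R →ₐ[k] C := Ideal.Quotient.liftₐ J φ₀ hJ
    refine ⟨φ, AlgHom.ext fun x ↦ ext_tensorCoeff b fun i ↦ ?_⟩
    simp only [AlgHom.comp_apply]
    rw [tensorCoeff_map, hυ]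
    exact MvPolynomial.aeval_X (fun xi : B × ι ↦ tensorCoeff b xi.2 (θ xi.1)) (x, i)

/-- Lifting `R → C ⧸ I` to `C` amounts to lifting `B → A ⊗ (C ⧸ I)` to `A ⊗ C`. The kernel there is
the extension of `I`, again of square zero, so étaleness of `B` gives a unique lift. -/
theorem etale_of_weilRestriction {k : Type u} [Field k] {A B R : Type u} [CommRing A] [CommRing B]
    [CommRing R] [Algebra k A] [Algebra k B] [Algebra k R] [Algebra.Etale k B]
    [Algebra.FiniteType k R] (υ : B →ₐ[k] A ⊗[k] R)
    (h : ∀ (C : Type u) [CommRing C] [Algebra k C], Function.Bijective fun φ : R →ₐ[k] C ↦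
        (Algebra.TensorProduct.map (AlgHom.id k A) φ).comp υ) : Algebra.Etale k R where
  finitePresentation := Algebra.FinitePresentation.of_finiteType.mp inferInstance
  formallyEtale := by
    refine Algebra.FormallyEtale.iff_comp_bijective.mpr fun C _ _ I hI ↦ ?_
    let π := Ideal.Quotient.mkₐ k I
    let g := Algebra.TensorProduct.map (AlgHom.id k A) π
    have hg : Function.Surjective g := LinearMap.lTensor_surjective A (g := π.toLinearMap)
      (Ideal.Quotient.mkₐ_surjective k I)
    have hker : IsNilpotent (RingHom.ker (g : A ⊗[k] C →+* A ⊗[k] (C ⧸ I))) := by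
      refine ⟨2, ?_⟩
      have h1 : RingHom.ker (g : A ⊗[k] C →+* A ⊗[k] (C ⧸ I)) =
          I.map (Algebra.TensorProduct.includeRight : C →ₐ[k] A ⊗[k] C) := by
        have := Algebra.TensorProduct.lTensor_ker (A := A) π (Ideal.Quotient.mkₐ_surjective k I)
        have hπ : RingHom.ker π = I := Ideal.Quotient.mkₐ_ker k I
        rwa [hπ] at this
      rw [h1, ← Ideal.map_pow, hI, Ideal.map_bot, Ideal.zero_eq_bot]
    have hcomp (φ : R →ₐ[k] C) : (Algebra.TensorProduct.map (AlgHom.id k A) (π.comp φ)).comp υ =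
        g.comp ((Algebra.TensorProduct.map (AlgHom.id k A) φ).comp υ) := by
      rw [← AlgHom.comp_assoc, ← Algebra.TensorProduct.map_comp, AlgHom.id_comp]
    constructor
    · intro φ ψ hφψ
      refine (h C).1 (Algebra.FormallyUnramified.lift_unique' g hker _ _ ?_)
      rw [← hcomp, ← hcomp]
      exact congrArg (fun χ ↦ (Algebra.TensorProduct.map (AlgHom.id k A) χ).comp υ) hφψ
    · intro ψ
      obtain ⟨φ, hφ⟩ := (h C).2 (Algebra.FormallySmooth.liftOfSurjective
        ((Algebra.TensorProduct.map (AlgHom.id k A) ψ).comp υ) g hg hker)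
      refine ⟨φ, (h (C ⧸ I)).1 ?_⟩
      simp only at hφ ⊢
      rw [hcomp, hφ, Algebra.FormallySmooth.comp_liftOfSurjective]

end WeilRestriction
end

/-! ### Universal morphisms and their Zariski-local nature. -/

section
open Limits
variable {k : Type u} [Field k]

/-- The restriction of a `k`-scheme to an open subset, as a `k`-scheme. -/
def restrictOver (S : Over (Spec (.of k))) (V : S.left.Opens) : Over (Spec (.of k)) :=
  Over.mk (V.ι ≫ S.hom)

/-- The inclusion of an open subscheme over `k`. -/
def restrictOverι (S : Over (Spec (.of k))) (V : S.left.Opens) : restrictOver S V ⟶ S :=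
  Over.homMk V.ι

/-- The morphism `u : E × N ⟶ H` exhibits `N` as representing `S ↦ Hom(E × S, H)`. -/
def IsUniversal {E N H : Over (Spec (.of k))} (u : E ⊗ N ⟶ H) : Prop :=
  ∀ S, Function.Bijective fun a : S ⟶ N ↦ (E ◁ a) ≫ u

theorem whiskerLeft_hom_ext {E S H : Over (Spec (.of k))} (𝒰 : Scheme.OpenCover.{u} S.left)
    {f g : E ⊗ S ⟶ H}
    (h : ∀ i, (E ◁ (Over.homMk (𝒰.f i) : Over.mk (𝒰.f i ≫ S.hom) ⟶ S)) ≫ f =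
      (E ◁ (Over.homMk (𝒰.f i) : Over.mk (𝒰.f i ≫ S.hom) ⟶ S)) ≫ g) : f = g := by
  ext : 1
  refine Scheme.Cover.hom_ext (Scheme.Pullback.openCoverOfRight 𝒰 E.hom S.hom) _ _ fun i ↦ ?_
  exact congrArg (·.left) (h i)

theorem isUniversal_of_local {E N H : Over (Spec (.of k))} (u : E ⊗ N ⟶ H)
    (inj : ∀ (S : Over (Spec (.of k))) (a b : S ⟶ N), (E ◁ a) ≫ u = (E ◁ b) ≫ u →
      ∀ s : S.left, ∃ V : S.left.Opens, s ∈ V ∧ restrictOverι S V ≫ a = restrictOverι S V ≫ b)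
    (surj : ∀ (S : Over (Spec (.of k))) (f : E ⊗ S ⟶ H) (s : S.left), ∃ V : S.left.Opens, s ∈ V ∧
      ∃ a : restrictOver S V ⟶ N, (E ◁ a) ≫ u = (E ◁ restrictOverι S V) ≫ f) :
    IsUniversal u := by
  have cover {S : Over (Spec (.of k))} {V : S.left → S.left.Opens} (hV : ∀ s, s ∈ V s) :
      TopologicalSpace.IsOpenCover V :=
    eq_top_iff.mpr fun s _ ↦ TopologicalSpace.Opens.mem_iSup.mpr ⟨s, hV s⟩
  -- Global uniqueness comes first: applied to overlaps, it makes the local solutions glue.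
  have inj' (S : Over (Spec (.of k))) (a b : S ⟶ N) (hab : (E ◁ a) ≫ u = (E ◁ b) ≫ u) : a = b := by
    choose V hV h using inj S a b hab
    ext : 1
    exact Scheme.Cover.hom_ext (S.left.openCoverOfIsOpenCover V (cover hV)) _ _
      fun s ↦ congrArg (·.left) (h s)
  refine fun S ↦ ⟨fun a b ↦ inj' S a b, fun f ↦ ?_⟩
  choose V hV a ha using surj S f
  let 𝒰 := S.left.openCoverOfIsOpenCover V (cover hV)
  let g : S.left ⟶ N.left := by
    refine Scheme.Cover.glueMorphisms 𝒰 (fun s ↦ (a s).left) fun (x y : S.left) ↦ ?_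
    let p : Over.mk (pullback.fst (𝒰.f x) (𝒰.f y) ≫ 𝒰.f x ≫ S.hom) ⟶ restrictOver S (V x) :=
      Over.homMk (pullback.fst (𝒰.f x) (𝒰.f y))
    let q : Over.mk (pullback.fst (𝒰.f x) (𝒰.f y) ≫ 𝒰.f x ≫ S.hom) ⟶ restrictOver S (V y) :=
      Over.homMk (pullback.snd (𝒰.f x) (𝒰.f y)) (pullback.condition_assoc _).symm
    have hpq : p ≫ restrictOverι S (V x) = q ≫ restrictOverι S (V y) := by
      ext : 1
      exact pullback.condition
    refine congrArg (·.left) (inj' _ (p ≫ a x) (q ≫ a y) ?_)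
    rw [whiskerLeft_comp, whiskerLeft_comp, Category.assoc, Category.assoc, ha, ha,
      ← whiskerLeft_comp_assoc, ← whiskerLeft_comp_assoc, hpq]
  have hg (s : S.left) : (V s).ι ≫ g = (a s).left := Scheme.Cover.ι_glueMorphisms 𝒰 _ _ s
  refine ⟨Over.homMk g ?_, ?_⟩
  · refine Scheme.Cover.hom_ext 𝒰 _ _ fun s ↦ ?_
    change (V s).ι ≫ g ≫ N.hom = (V s).ι ≫ S.hom
    rw [reassoc_of% hg s]
    exact Over.w (a s)
  · refine whiskerLeft_hom_ext 𝒰 fun s ↦ ?_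
    refine Eq.trans ?_ (ha s)
    rw [← whiskerLeft_comp_assoc]
    congr 2
    ext : 1
    exact hg s

theorem IsUniversal.comp_iso {E N H H' : Over (Spec (.of k))} {u : E ⊗ N ⟶ H} (hu : IsUniversal u)
    (e : H ≅ H') : IsUniversal (u ≫ e.hom) := fun S ↦ by
  have : (fun a : S ⟶ N ↦ (E ◁ a) ≫ u ≫ e.hom) =
      (fun f ↦ f ≫ e.hom) ∘ fun a : S ⟶ N ↦ (E ◁ a) ≫ u := by
    funext a; simp
  rw [this]
  exact Function.Bijective.comp ⟨fun f g h ↦ (cancel_mono e.hom).mp h, fun f ↦ ⟨f ≫ e.inv, by simp⟩⟩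
    (hu S)

end

/-! ### Representability for affine étale targets. -/

section
open scoped TensorProduct
open Limits
section
variable {k : Type u} [Field k] (A : Type u) [CommRing A] [Algebra k A]
  {C D : Type u} [CommRing C] [Algebra k C] [CommRing D] [Algebra k D]

variable (k) in
/-- The spectrum of a `k`-algebra as a `k`-scheme. -/
abbrev specOver (A : Type u) [CommRing A] [Algebra k A] : Over (Spec (.of k)) :=
  Over.mk (Spec.map (CommRingCat.ofHom (algebraMap k A)))

/-- The morphism of `k`-schemes given by a `k`-algebra homomorphism. -/
def specOverMap (φ : C →ₐ[k] D) : specOver k D ⟶ specOver k C :=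
  Over.homMk (Spec.map (CommRingCat.ofHom φ.toRingHom)) (by
    change Spec.map _ ≫ Spec.map _ = Spec.map _
    rw [← Spec.map_comp, ← CommRingCat.ofHom_comp]
    congr 2
    exact φ.comp_algebraMap)

theorem specOverMap_comp {F : Type u} [CommRing F] [Algebra k F] (φ : C →ₐ[k] D) (ψ : D →ₐ[k] F) :
    specOverMap (ψ.comp φ) = specOverMap ψ ≫ specOverMap φ := by
  ext : 1
  exact Spec.map_comp (CommRingCat.ofHom φ.toRingHom) (CommRingCat.ofHom ψ.toRingHom)

theorem bijective_specOverMap :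
    Function.Bijective (specOverMap : (C →ₐ[k] D) → (specOver k D ⟶ specOver k C)) := by
  constructor
  · intro φ ψ h
    have h' : CommRingCat.ofHom φ.toRingHom = CommRingCat.ofHom ψ.toRingHom :=
      Spec.map_injective (congrArg (·.left) h)
    ext x
    exact congrArg (fun f ↦ f.hom x) h'
  · intro f
    obtain ⟨g, hg⟩ := Spec.map_surjective f.left
    have hw : CommRingCat.ofHom (algebraMap k C) ≫ g = CommRingCat.ofHom (algebraMap k D) := by
      refine Spec.map_injective ?_
      rw [Spec.map_comp, hg]
      exact Over.w f
    refine ⟨⟨g.hom, fun c ↦ congrArg (fun f ↦ f.hom c) hw⟩, ?_⟩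
    ext : 1
    exact hg

variable (C) in
/-- The product of two affine `k`-schemes is the spectrum of the tensor product. -/
def specOverTensorIso : specOver k A ⊗ specOver k C ≅ specOver k (A ⊗[k] C) :=
  Over.isoMk (pullbackSpecIso k A C) (pullbackSpecIso_hom_base k A C)

theorem specOverTensorIso_naturality (φ : C →ₐ[k] D) :
    (specOver k A ◁ specOverMap φ) ≫ (specOverTensorIso A C).hom =
      (specOverTensorIso A D).hom ≫
        specOverMap (Algebra.TensorProduct.map (AlgHom.id k A) φ) := by
  rw [← Iso.inv_comp_eq, ← Category.assoc, ← Iso.eq_comp_inv]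
  refine Over.OverMorphism.ext ?_
  refine pullback.hom_ext (f := (specOver k A).hom) (g := (specOver k C).hom) ?_ ?_
  · have h1 : (specOver k A ◁ specOverMap φ).left ≫
        pullback.fst (specOver k A).hom (specOver k C).hom =
          pullback.fst (specOver k A).hom (specOver k D).hom :=
      Over.whiskerLeft_left_fst _
    refine (Category.assoc _ _ _).trans (((congrArg ((pullbackSpecIso k A D).inv ≫ ·) h1).trans
      (pullbackSpecIso_inv_fst k A D)).trans ?_)
    refine Eq.trans ?_ ((Category.assoc _ _ _).trans
      (congrArg (_ ≫ ·) (pullbackSpecIso_inv_fst k A C))).symm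
    change Spec.map _ = Spec.map _ ≫ Spec.map _
    rw [← Spec.map_comp]
    congr 1
    ext x
    simp
  · have h1 : (specOver k A ◁ specOverMap φ).left ≫
        pullback.snd (specOver k A).hom (specOver k C).hom =
          pullback.snd (specOver k A).hom (specOver k D).hom ≫ (specOverMap φ).left :=
      Over.whiskerLeft_left_snd _
    refine (Category.assoc _ _ _).trans (((congrArg ((pullbackSpecIso k A D).inv ≫ ·) h1).trans
      (pullbackSpecIso_inv_snd_assoc k A D _)).trans ?_)
    refine Eq.trans ?_ ((Category.assoc _ _ _).trans
      (congrArg (_ ≫ ·) (pullbackSpecIso_inv_snd k A C))).symm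
    change Spec.map _ ≫ Spec.map _ = Spec.map _ ≫ Spec.map _
    rw [← Spec.map_comp, ← Spec.map_comp]
    congr 1

theorem bijective_whiskerLeft_comp_specOver {B R : Type u} [CommRing B] [CommRing R] [Algebra k B]
    [Algebra k R] (υ : B →ₐ[k] A ⊗[k] R)
    (h : Function.Bijective fun φ : R →ₐ[k] C ↦
        (Algebra.TensorProduct.map (AlgHom.id k A) φ).comp υ) :
    Function.Bijective fun a : specOver k C ⟶ specOver k R ↦
      (specOver k A ◁ a) ≫ (specOverTensorIso A R).hom ≫ specOverMap υ := by
  rw [← Function.Bijective.of_comp_iff _ (bijective_specOverMap (C := R) (D := C))]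
  have : ((fun a : specOver k C ⟶ specOver k R ↦
      (specOver k A ◁ a) ≫ (specOverTensorIso A R).hom ≫ specOverMap υ) ∘ specOverMap) =
      (fun f ↦ (specOverTensorIso A C).hom ≫ f) ∘ specOverMap ∘ fun φ : R →ₐ[k] C ↦
        (Algebra.TensorProduct.map (AlgHom.id k A) φ).comp υ := by
    funext φ
    simp only [Function.comp_apply]
    rw [← Category.assoc, specOverTensorIso_naturality, specOverMap_comp, Category.assoc]
  rw [this]
  refine Function.Bijective.comp ⟨fun f g h ↦ (cancel_epi _).mp h,
    fun f ↦ ⟨(specOverTensorIso A C).inv ≫ f, by simp⟩⟩ (bijective_specOverMap.comp h)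

theorem bijective_whiskerLeft_comp_of_iso {E N H S S' : Over (Spec (.of k))} (u : E ⊗ N ⟶ H)
    (e : S ≅ S') (h : Function.Bijective fun a : S' ⟶ N ↦ (E ◁ a) ≫ u) :
    Function.Bijective fun a : S ⟶ N ↦ (E ◁ a) ≫ u := by
  have : (fun a : S ⟶ N ↦ (E ◁ a) ≫ u) =
      (fun f ↦ (E ◁ e.hom) ≫ f) ∘ (fun a : S' ⟶ N ↦ (E ◁ a) ≫ u) ∘ fun a ↦ e.inv ≫ a := by
    funext a
    simp
  rw [this]
  refine Function.Bijective.comp ⟨fun f g h ↦ (cancel_epi _).mp h, fun f ↦ ⟨(E ◁ e.inv) ≫ f, ?_⟩⟩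
    (h.comp ⟨fun f g h ↦ (cancel_epi _).mp h, fun f ↦ ⟨e.hom ≫ f, by simp⟩⟩)
  simp

theorem exists_iso_specOver (S : Over (Spec (.of k))) [IsAffine S.left] :
    ∃ (C : Type u) (_ : CommRing C) (_ : Algebra k C), Nonempty (S ≅ specOver k C) := by
  obtain ⟨ψ, hψ⟩ := Spec.map_surjective (S.left.isoSpec.inv ≫ S.hom)
  refine ⟨Γ(S.left, ⊤), inferInstance, ψ.hom.toAlgebra, ⟨Over.isoMk S.left.isoSpec ?_⟩⟩
  change S.left.isoSpec.hom ≫ Spec.map ψ = S.hom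
  rw [hψ, Iso.hom_inv_id_assoc]

/-- On affine test schemes this is the algebraic universal property; affine opens cover the rest. -/
theorem isUniversal_specOver {B R : Type u} [CommRing B] [CommRing R] [Algebra k B]
    [Algebra k R] (υ : B →ₐ[k] A ⊗[k] R)
    (h : ∀ (C : Type u) [CommRing C] [Algebra k C], Function.Bijective fun φ : R →ₐ[k] C ↦
        (Algebra.TensorProduct.map (AlgHom.id k A) φ).comp υ) :
    IsUniversal ((specOverTensorIso A R).hom ≫ specOverMap υ) := by
  have bij (S : Over (Spec (.of k))) [IsAffine S.left] :
      Function.Bijective fun a : S ⟶ specOver k R ↦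
        (specOver k A ◁ a) ≫ (specOverTensorIso A R).hom ≫ specOverMap υ := by
    obtain ⟨C, _, _, ⟨e⟩⟩ := exists_iso_specOver S
    exact bijective_whiskerLeft_comp_of_iso _ e (bijective_whiskerLeft_comp_specOver A υ (h C))
  have exV {X : Scheme.{u}} (s : X) : ∃ V : X.Opens, IsAffineOpen V ∧ s ∈ V := by
    obtain ⟨V, hV, hs, -⟩ := exists_isAffineOpen_mem_and_subset (x := s) (U := ⊤) trivial
    exact ⟨V, hV, hs⟩
  refine isUniversal_of_local _ (fun S a b hab s ↦ ?_) fun S f s ↦ ?_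
  · obtain ⟨V, hV, hs⟩ := exV s
    have : IsAffine (restrictOver S V).left := hV
    refine ⟨V, hs, (bij (restrictOver S V)).1 ?_⟩
    simp only [whiskerLeft_comp, Category.assoc, hab]
  · obtain ⟨V, hV, hs⟩ := exV s
    have : IsAffine (restrictOver S V).left := hV
    exact ⟨V, hs, (bij (restrictOver S V)).2 _⟩

/-- For a finite `k`-algebra `A` and an affine étale `k`-scheme `H`, the functor
`S ↦ Hom(Spec A × S, H)` is represented by a finite étale `k`-scheme. -/
theorem exists_isUniversal_of_isAffine [Module.Finite k A] (H : Over (Spec (.of k)))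
    [Etale H.hom] [IsAffine H.left] :
    ∃ (N : Over (Spec (.of k))) (u : specOver k A ⊗ N ⟶ H),
      IsUniversal u ∧ Etale N.hom ∧ IsFinite N.hom := by
  obtain ⟨B, _, _, ⟨e⟩⟩ := exists_iso_specOver H
  have hw : e.inv.left ≫ H.hom = Spec.map (CommRingCat.ofHom (algebraMap k B)) := Over.w e.inv
  have : IsIso e.inv.left := inferInstanceAs (IsIso ((Over.forget _).map e.inv))
  have h1 : Etale (Spec.map (CommRingCat.ofHom (algebraMap k B))) := by
    rw [← hw]; infer_instance
  have : Algebra.Etale k B := RingHom.etale_algebraMap.mp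
    ((HasRingHomProperty.Spec_iff (P := @Etale)).mp h1)
  -- Finiteness of `B` makes `R` of finite type, as étaleness of `R` requires.
  have : Module.Finite k B := Algebra.finite_of_etale B
  obtain ⟨R, _, _, υ, hft, hυ⟩ := exists_weilRestriction (k := k) A B
  have : Algebra.FiniteType k R := hft inferInstance
  have : Algebra.Etale k R := etale_of_weilRestriction υ hυ
  have : Module.Finite k R := Algebra.finite_of_etale R
  exact ⟨specOver k R, _, (isUniversal_specOver A υ hυ).comp_iso e.symm,
    (HasRingHomProperty.Spec_iff (P := @Etale)).mpr (RingHom.etale_algebraMap.mpr inferInstance),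
    (IsFinite.SpecMap_iff _).mpr <| RingHom.finite_algebraMap.mpr inferInstance⟩

end
end

/-! ### Images of fibres, and the stratum of a finite set `U`. -/

section
open Limits
variable {k : Type u} [Field k]

theorem isPullback_whiskerLeft (E : Over (Spec (.of k))) {S S' : Over (Spec (.of k))} (a : S' ⟶ S) :
    IsPullback (E ◁ a).left (pullback.snd E.hom S'.hom) (pullback.snd E.hom S.hom) a.left := by
  refine IsPullback.of_right (h₁₂ := pullback.fst E.hom S.hom) (h₂₂ := S.hom) (v₁₃ := E.hom) ?_
    (Over.whiskerLeft_left_snd _) (IsPullback.of_hasPullback _ _)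
  have h := IsPullback.of_hasPullback E.hom S'.hom
  have e : (E ◁ a).left ≫ pullback.fst E.hom S.hom = pullback.fst E.hom S'.hom :=
    Over.whiskerLeft_left_fst _
  rw [e, Over.w a]
  exact h

theorem exists_comp_eq_of_range_subset {S M N : Over (Spec (.of k))} (i : M ⟶ N)
    [IsOpenImmersion i.left] (a : S ⟶ N) (h : Set.range a.left ⊆ Set.range i.left) :
    ∃ a' : S ⟶ M, a' ≫ i = a := by
  refine ⟨Over.homMk (IsOpenImmersion.lift i.left a.left h) ?_, ?_⟩
  · rw [← Over.w i, IsOpenImmersion.lift_fac_assoc, Over.w]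
  · ext : 1
    exact IsOpenImmersion.lift_fac _ _ _

instance (S : Over (Spec (.of k))) (V : S.left.Opens) : IsOpenImmersion (restrictOverι S V).left :=
  inferInstanceAs (IsOpenImmersion V.ι)

instance (S : Over (Spec (.of k))) (V : S.left.Opens) : Mono (restrictOverι S V) :=
  have : Mono ((Over.forget _).map (restrictOverι S V)) := inferInstanceAs (Mono V.ι)
  (Over.forget _).mono_of_mono_map this

instance (S : Over (Spec (.of k))) [Etale S.hom] (V : S.left.Opens) :
    Etale (restrictOver S V).hom :=
  inferInstanceAs (Etale (V.ι ≫ S.hom))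

theorem range_restrictOverι (S : Over (Spec (.of k))) (V : S.left.Opens) :
    Set.range (restrictOverι S V).left = V :=
  Scheme.Opens.range_ι V

section FiberImage

variable {E S H : Over (Spec (.of k))}

/-- The image under `f : E × S ⟶ H` of the fibre of `E × S` over a point `s` of `S`. -/
def fiberImage (f : E ⊗ S ⟶ H) (s : S.left) : Set H.left :=
  f.left '' (pullback.snd E.hom S.hom ⁻¹' {s})

/-- The fibre of `E × S'` over `s` maps onto that of `E × S` over `a s`, by lifting points to a
fibre product. -/
theorem fiberImage_whiskerLeft_comp {S' : Over (Spec (.of k))} (a : S' ⟶ S) (f : E ⊗ S ⟶ H)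
    (s : S'.left) : fiberImage ((E ◁ a) ≫ f) s = fiberImage f (a.left s) := by
  have hpb := isPullback_whiskerLeft E a
  ext y
  constructor
  · rintro ⟨x, hx, rfl⟩
    refine ⟨(E ◁ a).left x, ?_, rfl⟩
    have hx' : pullback.snd E.hom S'.hom x = s := hx
    have := congrArg (fun f ↦ f x) hpb.w
    refine Eq.trans this ?_
    exact congrArg a.left hx'
  · rintro ⟨x, hx, rfl⟩
    obtain ⟨x', h1, h2⟩ := Scheme.exists_preimage_of_isPullback hpb x s hx
    refine ⟨x', h2, ?_⟩
    exact congrArg f.left h1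

theorem finite_fiberImage [IsFinite E.hom] (f : E ⊗ S ⟶ H) (s : S.left) :
    (fiberImage f s).Finite :=
  ((pullback.snd E.hom S.hom).finite_preimage_singleton s).image _

/-- The projection `E × S ⟶ S` is closed, being finite, and open, being étale. As `H` is discrete,
closedness makes "image inside `U`" an open condition, and openness does so for "image contains `y`"
for each of the finitely many `y ∈ U`. -/
theorem isOpen_setOf_fiberImage_eq [IsFinite E.hom] [Etale E.hom] [Etale H.hom] (f : E ⊗ S ⟶ H)
    {U : Set H.left} (hU : U.Finite) : IsOpen {s | fiberImage f s = U} := by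
  have : DiscreteTopology H.left := discreteTopology_of_etale H.hom
  have hopen : IsOpenMap (pullback.snd E.hom S.hom) := (pullback.snd E.hom S.hom).isOpenMap
  have hclosed : IsClosedMap (pullback.snd E.hom S.hom) := (pullback.snd E.hom S.hom).isClosedMap
  have h : {s | fiberImage f s = U} = (pullback.snd E.hom S.hom '' (f.left ⁻¹' Uᶜ))ᶜ ∩
      ⋂ y ∈ U, pullback.snd E.hom S.hom '' (f.left ⁻¹' {y}) := by
    ext s
    simp only [Set.mem_ofPred_eq, Set.mem_inter_iff, Set.mem_iInter, Set.Subset.antisymm_iff]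
    refine and_congr ⟨?_, ?_⟩ ⟨?_, ?_⟩
    · rintro h ⟨x, hx, hxs⟩
      exact hx (h ⟨x, hxs, rfl⟩)
    · rintro h _ ⟨x, hx, rfl⟩
      by_contra hxU
      exact h ⟨x, hxU, hx⟩
    · intro h y hy
      obtain ⟨x, hx, hxy⟩ := h hy
      exact ⟨x, hxy, hx⟩
    · intro h y hy
      obtain ⟨x, hx, hxy⟩ := h y hy
      exact ⟨x, hxy, hx⟩
  rw [h]
  refine (hclosed _ ((isClosed_discrete _).preimage f.left.continuous)).isOpen_compl.inter ?_
  exact hU.isOpen_biInter fun y _ ↦ hopen _ ((isOpen_discrete _).preimage f.left.continuous)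

end FiberImage

variable {E H : Over (Spec (.of k))}

/-- Morphisms `E × S ⟶ H` for which every fibre over `S` has image a given finite set `U` are
represented by an étale `k`-scheme, provided morphisms to affine étale schemes are. -/
theorem exists_isUniversal_fiberImage [IsFinite E.hom] [Etale E.hom] [Etale H.hom]
    (h : ∀ H' : Over (Spec (.of k)), Etale H'.hom → IsAffine H'.left →
      ∃ (N : Over (Spec (.of k))) (u : E ⊗ N ⟶ H'), IsUniversal u ∧ Etale N.hom)
    {U : Set H.left} (hU : U.Finite) :
    ∃ (M : Over (Spec (.of k))) (w : E ⊗ M ⟶ H), Etale M.hom ∧ (∀ m, fiberImage w m = U) ∧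
      (∀ S, Function.Injective fun a : S ⟶ M ↦ (E ◁ a) ≫ w) ∧
      ∀ (S : Over (Spec (.of k))) (f : E ⊗ S ⟶ H), (∀ s, fiberImage f s = U) →
        ∃ a : S ⟶ M, (E ◁ a) ≫ w = f := by
  have : DiscreteTopology H.left := discreteTopology_of_etale H.hom
  let V : H.left.Opens := ⟨U, isOpen_discrete U⟩
  have : Finite V := hU
  have : DiscreteTopology V := inferInstanceAs (DiscreteTopology U)
  have hV : IsAffine (restrictOver H V).left := inferInstanceAs (IsAffine V.toScheme)
  obtain ⟨N, u, hu, hN⟩ := h (restrictOver H V) inferInstance hV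
  let v := u ≫ restrictOverι H V
  -- `N` only forces images to lie inside `U`; on `O` they are all of `U`, which keeps the strata
  -- for different `U` disjoint.
  let O : N.left.Opens := ⟨_, isOpen_setOf_fiberImage_eq v hU⟩
  refine ⟨restrictOver N O, (E ◁ restrictOverι N O) ≫ v, inferInstance, fun m ↦ ?_,
    fun S a b hab ↦ ?_, fun S f hf ↦ ?_⟩
  · rw [fiberImage_whiskerLeft_comp]
    have : (restrictOverι N O).left m ∈ (O : Set N.left) :=
      range_restrictOverι N O ▸ Set.mem_range_self m
    exact this
  · rw [← cancel_mono (restrictOverι N O)]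
    refine (hu S).1 ?_
    rw [← cancel_mono (restrictOverι H V)]
    simpa [v] using hab
  · have hrange : Set.range f.left ⊆ Set.range (restrictOverι H V).left := by
      rw [range_restrictOverι]
      rintro _ ⟨x, rfl⟩
      exact (hf (pullback.snd E.hom S.hom x)).le ⟨x, rfl, rfl⟩
    obtain ⟨f', rfl⟩ := exists_comp_eq_of_range_subset _ f hrange
    obtain ⟨a, rfl⟩ := (hu S).2 f'
    have ha : Set.range a.left ⊆ Set.range (restrictOverι N O).left := by
      rw [range_restrictOverι]
      rintro _ ⟨s, rfl⟩
      change fiberImage v _ = U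
      rw [← fiberImage_whiskerLeft_comp, ← hf s, Category.assoc]
    obtain ⟨a', rfl⟩ := exists_comp_eq_of_range_subset _ a ha
    exact ⟨a', by simp [v]⟩

end

/-! ### Disjoint unions of strata, and the general étale target. -/

section
open Limits
variable {k : Type u} [Field k]

section Coproduct

variable {σ : Type u} (M : σ → Over (Spec (.of k)))

/-- The disjoint union of a family of `k`-schemes. -/
def sigmaOver : Over (Spec (.of k)) :=
  Over.mk (Sigma.desc fun i ↦ (M i).hom)

/-- The inclusion of a summand into the disjoint union of `k`-schemes. -/
def sigmaOverι (i : σ) : M i ⟶ sigmaOver M :=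
  Over.homMk (Sigma.ι (fun i ↦ (M i).left) i) (Sigma.ι_desc (f := fun i ↦ (M i).left) _ _)

instance (i : σ) : IsOpenImmersion (sigmaOverι M i).left :=
  inferInstanceAs (IsOpenImmersion (Sigma.ι (fun i ↦ (M i).left) i))

theorem exists_sigmaOverι_eq (x : (sigmaOver M).left) :
    ∃ (i : σ) (y : (M i).left), (sigmaOverι M i).left y = x :=
  (sigmaOpenCover fun i ↦ (M i).left).exists_eq x

theorem etale_sigmaOver (h : ∀ i, Etale (M i).hom) : Etale (sigmaOver M).hom :=
  have : IsZariskiLocalAtSource @Etale :=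
    HasRingHomProperty.instIsZariskiLocalAtSource (Q := RingHom.Etale)
  IsZariskiLocalAtSource.sigmaDesc (P := @Etale) h

-- The preimages of the summands cover `E ⊗ sigmaOver M` and are pairwise disjoint, so gluing needs
-- no compatibility between different summands.
variable {M} in
theorem exists_whiskerLeft_sigmaOverι_comp_eq {E H : Over (Spec (.of k))} (w : ∀ i, E ⊗ M i ⟶ H) :
    ∃ u : E ⊗ sigmaOver M ⟶ H, ∀ i, (E ◁ sigmaOverι M i) ≫ u = w i := by
  let 𝒱 : (sigmaOver M).left.OpenCover := sigmaOpenCover fun i ↦ (M i).left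
  let M' (i : σ) : Over (Spec (.of k)) := Over.mk (𝒱.f i ≫ (sigmaOver M).hom)
  let e (i : σ) : M' i ≅ M i := Over.isoMk (Iso.refl _)
    ((Category.id_comp _).trans (Over.w (sigmaOverι M i)).symm)
  let 𝒰 := Scheme.Pullback.openCoverOfRight 𝒱 E.hom (sigmaOver M).hom
  have h𝒰 (i : σ) : 𝒰.f i ≫ pullback.snd E.hom (sigmaOver M).hom =
      pullback.snd E.hom (M' i).hom ≫ 𝒱.f i := pullback.lift_snd _ _ _
  have he (i : σ) : (E ◁ ((e i).hom ≫ sigmaOverι M i)).left = 𝒰.f i := by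
    have : (e i).hom ≫ sigmaOverι M i = Over.homMk (U := M' i) (𝒱.f i) rfl := by
      ext : 1
      exact Category.id_comp _
    rw [this]
    rfl
  let w' (i : σ) : 𝒰.X i ⟶ H.left := ((E ◁ (e i).hom) ≫ w i).left
  have compat (i j : σ) : pullback.fst (𝒰.f i) (𝒰.f j) ≫ w' i =
      pullback.snd (𝒰.f i) (𝒰.f j) ≫ w' j := by
    by_cases hij : i = j
    · subst hij
      have : IsOpenImmersion (𝒰.f i) := 𝒰.map_prop i
      congr 1
      exact (cancel_mono (𝒰.f i)).mp pullback.condition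
    · have : IsEmpty ↥(pullback (𝒰.f i) (𝒰.f j)) :=
        isEmpty_of_commSq_sigmaι_of_ne (g := fun i ↦ (M i).left)
          (a := pullback.fst (𝒰.f i) (𝒰.f j) ≫ pullback.snd E.hom (M' i).hom)
          (b := pullback.snd (𝒰.f i) (𝒰.f j) ≫ pullback.snd E.hom (M' j).hom)
          ⟨by
            refine (Category.assoc _ _ _).trans (Eq.trans ?_ (Category.assoc _ _ _).symm)
            refine (congrArg (_ ≫ ·) (h𝒰 i)).symm.trans (Eq.trans ?_ (congrArg (_ ≫ ·) (h𝒰 j)))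
            exact pullback.condition_assoc _⟩ hij
      exact isInitialOfIsEmpty.hom_ext _ _
  let u := Scheme.Cover.glueMorphisms 𝒰 w' compat
  have hu (i : σ) : 𝒰.f i ≫ u = w' i := Scheme.Cover.ι_glueMorphisms 𝒰 _ _ i
  refine ⟨Over.homMk u ?_, fun i ↦ ?_⟩
  · refine Scheme.Cover.hom_ext 𝒰 _ _ fun i ↦ ?_
    refine (Category.assoc _ _ _).symm.trans ((congrArg (· ≫ H.hom) (hu i)).trans
      ((Over.w ((E ◁ (e i).hom) ≫ w i)).trans ?_))
    exact (Over.w (E ◁ ((e i).hom ≫ sigmaOverι M i))).symm.trans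
      (congrArg (· ≫ (E ⊗ sigmaOver M).hom) (he i))
  · rw [← cancel_epi (E ◁ (e i).hom), ← whiskerLeft_comp_assoc]
    refine Over.OverMorphism.ext ((congrArg (· ≫ u) (he i)).trans (hu i))

end Coproduct

variable {E H : Over (Spec (.of k))}

/-- If `E` is finite étale and the functors `S ↦ Hom(E × S, H')` are representable by étale schemes
for affine étale `H'`, then they are so for all étale `H'`. -/
theorem exists_isUniversal_of_forall_isAffine [IsFinite E.hom] [Etale E.hom] [Etale H.hom]
    (h : ∀ H' : Over (Spec (.of k)), Etale H'.hom → IsAffine H'.left →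
      ∃ (N : Over (Spec (.of k))) (u : E ⊗ N ⟶ H'), IsUniversal u ∧ Etale N.hom) :
    ∃ (N : Over (Spec (.of k))) (u : E ⊗ N ⟶ H), IsUniversal u ∧ Etale N.hom := by
  choose M w hM hw inj surj using fun U : {U : Set H.left // U.Finite} ↦
    exists_isUniversal_fiberImage h U.2
  obtain ⟨u, hu⟩ := exists_whiskerLeft_sigmaOverι_comp_eq w
  have hfiber (U : {U : Set H.left // U.Finite}) (m : (M U).left) :
      fiberImage u ((sigmaOverι M U).left m) = U := by
    rw [← fiberImage_whiskerLeft_comp, hu, hw]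
  refine ⟨sigmaOver M, u, isUniversal_of_local u (fun S a b hab s ↦ ?_) fun S f s ↦ ?_,
    etale_sigmaOver M hM⟩
  · obtain ⟨U, m, hm⟩ := exists_sigmaOverι_eq M (a.left s)
    obtain ⟨U', m', hm'⟩ := exists_sigmaOverι_eq M (b.left s)
    -- The fibre image at a point determines its summand, so `a` and `b` send `s` to the same one.
    obtain rfl : U = U' := by
      ext1
      rw [← hfiber U m, ← hfiber U' m', hm, hm', ← fiberImage_whiskerLeft_comp,
        ← fiberImage_whiskerLeft_comp, hab]
    let O := (sigmaOverι M U).left.opensRange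
    let V : S.left.Opens := (a.left ⁻¹ᵁ O) ⊓ (b.left ⁻¹ᵁ O)
    refine ⟨V, ⟨⟨m, hm⟩, ⟨m', hm'⟩⟩, ?_⟩
    have hV (x) : (restrictOverι S V).left x ∈ (V : Set S.left) :=
      range_restrictOverι S V ▸ Set.mem_range_self x
    obtain ⟨a', ha'⟩ := exists_comp_eq_of_range_subset (sigmaOverι M U) (restrictOverι S V ≫ a) (by
      rintro _ ⟨x, rfl⟩
      exact (hV x).1)
    obtain ⟨b', hb'⟩ := exists_comp_eq_of_range_subset (sigmaOverι M U) (restrictOverι S V ≫ b) (by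
      rintro _ ⟨x, rfl⟩
      exact (hV x).2)
    rw [← ha', ← hb']
    congr 1
    refine inj U _ ?_
    simp only [← hu, ← whiskerLeft_comp_assoc, ha', hb']
    simp only [whiskerLeft_comp_assoc, hab]
  · let U : {U : Set H.left // U.Finite} := ⟨fiberImage f s, finite_fiberImage f s⟩
    let V : S.left.Opens := ⟨_, isOpen_setOf_fiberImage_eq f U.2⟩
    obtain ⟨a, ha⟩ := surj U (restrictOver S V) ((E ◁ restrictOverι S V) ≫ f) fun x ↦ by
      rw [fiberImage_whiskerLeft_comp]
      have : (restrictOverι S V).left x ∈ (V : Set S.left) :=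
        range_restrictOverι S V ▸ Set.mem_range_self x
      exact this
    exact ⟨V, rfl, a ≫ sigmaOverι M U, by rw [whiskerLeft_comp_assoc, hu, ha]⟩

/-- A universal morphism `E × N ⟶ H` to a group scheme makes `N` a group scheme representing
`𝐇𝐨𝐦(E, H)`. -/
theorem IsUniversal.exists_iso_homFunctor [GrpObj H] {N : Over (Spec (.of k))} {u : E ⊗ N ⟶ H}
    (hu : IsUniversal u) :
    ∃ _ : GrpObj N, Nonempty (yonedaGrpObj N ≅ homFunctor E H) := by
  let r : (homFunctor E H ⋙ forget GrpCat).RepresentableBy N :=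
    { homEquiv := fun {S} ↦ Equiv.ofBijective (fun a : S ⟶ N ↦ (E ◁ a) ≫ u) (hu S)
      homEquiv_comp := fun f g ↦ by
        change (E ◁ (f ≫ g)) ≫ u = (E ◁ f) ≫ (E ◁ g) ≫ u
        rw [whiskerLeft_comp_assoc] }
  exact ⟨GrpObj.ofRepresentableBy N _ r, ⟨yonedaGrpObjIsoOfRepresentableBy N _ r⟩⟩

end

end HomEtale

open HomEtale in
/-- `G` is an algebraic group (a group scheme of finite type) over the field `k`, and `H` is an
étale `k`-group scheme. -/
theorem proposition4p1 {k : Type u} [Field k]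
    (G : Over (Spec (.of k))) [GrpObj G] [LocallyOfFiniteType G.hom] [QuasiCompact G.hom]
    (H : Over (Spec (.of k))) [GrpObj H] [Etale H.hom] :
    IsIso (HomEtale.homFunctorPullback (HomEtale.toPiZero G) H) ∧
    ∃ (N : Over (Spec (.of k))) (_ : GrpObj N),
      Nonempty (yonedaGrpObj N ≅ HomEtale.homFunctor G H) ∧
      Etale N.hom ∧
      (IsFinite H.hom → IsFinite N.hom) := by
  have hiso := isIso_homFunctorPullback_toPiZero G H
  have := etale_piZero_hom G
  have := isFinite_piZero_hom G
  have := etale_maxEtaleSubalgebra_globalFunctions G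
  have : Module.Finite k (maxEtaleSubalgebra k (GlobalFunctions G)) := Algebra.finite_of_etale _
  have key : ∃ (N : Over (Spec (.of k))) (u : piZero G ⊗ N ⟶ H), IsUniversal u ∧ Etale N.hom ∧
      (IsFinite H.hom → IsFinite N.hom) := by
    -- A finite `H` is affine, and the Weil restriction is then visibly finite; the disjoint union
    -- of strata serves only the remaining case.
    by_cases hH : IsFinite H.hom
    · have : IsAffine H.left := isAffine_of_isAffineHom H.hom
      obtain ⟨N, u, hu, hN, hfin⟩ := exists_isUniversal_of_isAffine
        (maxEtaleSubalgebra k (GlobalFunctions G)) H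
      exact ⟨N, u, hu, hN, fun _ ↦ hfin⟩
    · obtain ⟨N, u, hu, hN⟩ := exists_isUniversal_of_forall_isAffine (E := piZero G) (H := H)
        fun H' _ _ ↦ by
          obtain ⟨N, u, hu, hN, -⟩ := exists_isUniversal_of_isAffine
            (maxEtaleSubalgebra k (GlobalFunctions G)) H'
          exact ⟨N, u, hu, hN⟩
      exact ⟨N, u, hu, hN, fun h ↦ absurd h hH⟩
  obtain ⟨N, u, hu, hN, hfin⟩ := key
  obtain ⟨_, ⟨e⟩⟩ := hu.exists_iso_homFunctor
  exact ⟨hiso, N, _, ⟨e ≪≫ asIso (homFunctorPullback (toPiZero G) H)⟩, hN, hfin⟩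

end
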